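/- Let $K$ be a cyclic cubic field (a Galois extension of $\mathbb Q$ of degree $3$), with ring of integers $\mathcal O_K$ and $G=\mathrm{Gal}(K/\mathbb Q)$. Let $c_K$ be its conductor, i.e. the least integer $m\ge 1$ such that $K$ embeds into $\mathbb Q(\zeta_m)$. There is a unique integral ideal of $\mathcal O_K$ of norm $c_K$; denote it by $\mathfrak C_K$. Call $K$ monogenic if $\mathcal O_K=\mathbb Z[\gamma]$ for some $\gamma$. For an integer $t\ge -1$ put $\Delta_t=t^2+3t+9$, let $\theta_t$ be a root of $x^3-tx^2-(t+3)x-1$ and $K_t=\mathbb Q(\theta_t)$; this is a cyclic cubic field. $K$ is called a simplest cubic field if $K=K_t$ for some integer $t\ge -1$. When $K=K_t$, fix any root $\theta_t\in K$ and let $\sigma_t$ be the generator of $G$ with $\sigma_t(\theta_t)=-(1+\theta_t)/\theta_t$. For a generator $\sigma$ of $G$ put $$H^1(G,\mathcal O_K^\times)=\{u\in\mathcal O_K^\times : N_{K/\mathbb Q}(u)=1\}/\{\sigma(u)/u : u\in\mathcal O_K^\times\},$$ and write $[u]$ for the class of $u$. Let $P_K^G$ be the group of principal fractional ideals of $K$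 fixed by $G$, and $P_{\mathbb Q}\subset P_K^G$ the subgroup of ideals $q\mathcal O_K$ with $q\in\mathbb Q^\times$. (i) If $K$ is monogenic, then $K$ is a simplest cubic field and $\mathfrak C_K$ is principal. (ii) Suppose that $K$ is a simplest cubic field and $\mathfrak C_K=(\beta)$ with $\beta\in\mathcal O_K$. Then the following are equivalent: (a) $K$ is monogenic; (b) there is an integer $t\ge -1$ with $K=K_t$ such that, with $\sigma=\sigma_t$, $[\sigma(\beta)/\beta]=[\theta_t]$ in $H^1(G,\mathcal O_K^\times)$; (c) there is an integer $t\ge -1$ with $K=K_t$ such that, with $\sigma=\sigma_t$, the ideals $\mathfrak C_K$ and $(\theta_t-\sigma(\theta_t))$ lie in $P_K^G$ and have the same class in $P_K^G/P_{\mathbb Q}$; (d) there is an integer $t\ge -1$ with $K=K_t$ such that $\Delta_t/c_K=n^3$ for some $n\in\mathbb N$. Moreover, for every generator $\sigma$ of $G$, $\sigma(\beta)/\beta$ is a unit of $\mathcal O_K$ of norm $1$, and its class in $H^1(G,\mathcal O_K^\times)$ does not depend on the choice of the generator $\beta$ of $\mathfrak C_K$. -/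

import Mathlib

open NumberField
open scoped nonZeroDivisors IntermediateField

noncomputable section

namespace CyclicCubic

/-- `K` has a power integral basis: `𝓞 K = ℤ[γ]` for some `γ`. -/
def IsMonogenic (K : Type*) [Field K] : Prop :=
  ∃ γ : 𝓞 K, Algebra.adjoin ℤ {γ} = ⊤

/-- The conductor of an abelian number field `K`: the least positive integer `m` such that
`K` embeds into the `m`-th cyclotomic field. -/
def conductor (K : Type*) [Field K] [CharZero K] : ℕ :=
  sInf {m : ℕ | 0 < m ∧ Nonempty (K →ₐ[ℚ] CyclotomicField m ℚ)}

/-- `Δ_t = t² + 3t + 9`. -/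
def shanksDelta (t : ℤ) : ℤ := t ^ 2 + 3 * t + 9

/-- `θ` is a root of Shanks' polynomial `X³ - tX² - (t+3)X - 1`. -/
def IsShanksRoot {K : Type*} [Field K] (t : ℤ) (θ : K) : Prop :=
  θ ^ 3 - (t : K) * θ ^ 2 - ((t : K) + 3) * θ - 1 = 0

/-- `K = K_t` with `t ≥ -1`, where `θ` plays the role of `θ_t`: `θ` is a root of the Shanks
polynomial with parameter `t`, and `K = ℚ(θ)`. -/
def IsSimplestWith {K : Type*} [Field K] [CharZero K] (t : ℤ) (θ : K) : Prop :=
  -1 ≤ t ∧ IsShanksRoot t θ ∧ ℚ⟮θ⟯ = ⊤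

/-- `K` is (isomorphic to) the field `K_t`, with `t ≥ -1`. -/
def IsSimplestField (K : Type*) [Field K] [CharZero K] (t : ℤ) : Prop :=
  ∃ θ : K, IsSimplestWith t θ

/-- `K` is a simplest cubic field. -/
def IsSimplest (K : Type*) [Field K] [CharZero K] : Prop :=
  ∃ t : ℤ, IsSimplestField K t

/-- `σ` generates `Gal(K/ℚ)`. -/
def IsGaloisGenerator {K : Type*} [Field K] [CharZero K] (σ : K ≃ₐ[ℚ] K) : Prop :=
  Subgroup.zpowers σ = ⊤

/-- `K = K_t = ℚ(θ)` with `θ = θ_t`, and `σ` is the generator of `Gal(K/ℚ)` normalised by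
`σ(θ_t) = -(1 + θ_t)/θ_t`. -/
def IsShanksDatum {K : Type*} [Field K] [CharZero K] (t : ℤ) (θ : K) (σ : K ≃ₐ[ℚ] K) : Prop :=
  IsSimplestWith t θ ∧ IsGaloisGenerator σ ∧ σ θ = -((1 + θ) / θ)

section Units

variable (K : Type*) [Field K] [NumberField K]

/-- The norm `N_{K/ℚ}` on units of `𝓞 K`. -/
def unitNorm : (𝓞 K)ˣ →* ℚ :=
  (Algebra.norm ℚ).comp (((algebraMap (𝓞 K) K) : 𝓞 K →* K).comp (Units.coeHom (𝓞 K)))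

/-- The group of units of `𝓞 K` of norm `1`. -/
def normOneUnits : Subgroup (𝓞 K)ˣ := (unitNorm K).ker

variable {K}

/-- The homomorphism `u ↦ u^{σ-1} = σ(u)/u` on the units of `𝓞 K`. -/
def unitSigmaSubOne (σ : K ≃ₐ[ℚ] K) : (𝓞 K)ˣ →* (𝓞 K)ˣ :=
  Units.map ((RingOfIntegers.mapRingEquiv (σ : K ≃+* K) : 𝓞 K →+* 𝓞 K) : 𝓞 K →* 𝓞 K) /
    MonoidHom.id _

theorem unitSigmaSubOne_apply (σ : K ≃ₐ[ℚ] K) (u : (𝓞 K)ˣ) :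
    ((unitSigmaSubOne σ u : 𝓞 K) : K) = σ ((u : 𝓞 K) : K) / ((u : 𝓞 K) : K) := by
  have hu : ((u : 𝓞 K) : K) ≠ 0 := by simp
  rw [eq_div_iff hu, ← map_mul, ← Units.val_mul]
  simp only [unitSigmaSubOne, MonoidHom.div_apply, MonoidHom.id_apply, div_mul_cancel]
  rfl

/-- `H¹(G, 𝓞_Kˣ) = {u | N(u) = 1} / {u^{σ-1}}`, for a generator `σ` of `G = Gal(K/ℚ)`. -/
abbrev H1 (σ : K ≃ₐ[ℚ] K) : Type _ :=
  normOneUnits K ⧸ (unitSigmaSubOne σ).range.subgroupOf (normOneUnits K)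

/-- The class `[u] ∈ H¹(G, 𝓞_Kˣ)` of a unit `u` of norm `1`. -/
def H1.mk (σ : K ≃ₐ[ℚ] K) (u : normOneUnits K) : H1 σ := QuotientGroup.mk u

/-- The unit `u` of norm `1`, viewed as an element of `K`. -/
def normOneUnits.val (u : normOneUnits K) : K := ((u : (𝓞 K)ˣ) : 𝓞 K)

end Units

section Ideals

variable (K : Type*) [Field K] [NumberField K]

/-- `σ(A) = A` for all `σ ∈ Gal(K/ℚ)`: the fractional ideal `A` is ambiguous. -/
def IsAmbiguous {K : Type*} [Field K] [NumberField K] (A : FractionalIdeal (𝓞 K)⁰ K) : Prop :=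
  ∀ σ : K ≃ₐ[ℚ] K, σ '' {x : K | x ∈ A} = {x : K | x ∈ A}

theorem isAmbiguous_iff {K : Type*} [Field K] [NumberField K]
    (A : FractionalIdeal (𝓞 K)⁰ K) :
    IsAmbiguous A ↔ ∀ σ : K ≃ₐ[ℚ] K, ∀ x ∈ A, σ x ∈ A := by
  constructor
  · intro h σ x hx
    have hmem : σ x ∈ σ '' {x : K | x ∈ A} := ⟨x, hx, rfl⟩
    rw [h σ] at hmem
    exact hmem
  · intro h σ
    ext x
    constructor
    · rintro ⟨y, hy, rfl⟩
      exact h σ y hy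
    · intro hx
      exact ⟨σ.symm x, h σ.symm x hx, σ.apply_symm_apply x⟩

/-- `I_K^G`: the group of ambiguous ideals. -/
def ambiguousIdeals : Subgroup (FractionalIdeal (𝓞 K)⁰ K)ˣ where
  carrier := {A | IsAmbiguous (A : FractionalIdeal (𝓞 K)⁰ K)}
  mul_mem' {A B} ha hb := by
    simp only [Set.mem_ofPred_eq, isAmbiguous_iff, Units.val_mul] at ha hb ⊢
    intro σ x hx
    refine FractionalIdeal.mul_induction_on hx (fun i hi j hj => ?_) (fun y z hy hz => ?_)
    · rw [map_mul]
      exact FractionalIdeal.mul_mem_mul (ha σ i hi) (hb σ j hj)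
    · rw [map_add]
      exact Submodule.add_mem _ hy hz
  one_mem' := by
    simp only [Set.mem_ofPred_eq, isAmbiguous_iff, Units.val_one]
    intro σ x hx
    obtain ⟨r, rfl⟩ := (FractionalIdeal.mem_one_iff _).1 hx
    exact (FractionalIdeal.mem_one_iff _).2
      ⟨RingOfIntegers.mapRingEquiv (σ : K ≃+* K) r, rfl⟩
  inv_mem' {A} ha := by
    simp only [Set.mem_ofPred_eq, isAmbiguous_iff] at ha ⊢
    intro σ x hx
    have hA : (A : FractionalIdeal (𝓞 K)⁰ K) ≠ 0 := A.ne_zero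
    rw [Units.val_inv_eq_inv_val] at hx ⊢
    rw [FractionalIdeal.mem_inv_iff hA] at hx ⊢
    intro y hy
    obtain ⟨r, hr⟩ := (FractionalIdeal.mem_one_iff _).1 (hx _ (ha σ.symm y hy))
    refine (FractionalIdeal.mem_one_iff _).2
      ⟨RingOfIntegers.mapRingEquiv (σ : K ≃+* K) r, ?_⟩
    have h2 : σ (algebraMap (𝓞 K) K r) = σ x * y := by
      rw [hr, map_mul, AlgEquiv.apply_symm_apply]
    exact h2

/-- `P_K^G = I_K^G ∩ P_K`: the group of principal ambiguous ideals. -/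
def principalAmbiguousIdeals : Subgroup (FractionalIdeal (𝓞 K)⁰ K)ˣ :=
  ambiguousIdeals K ⊓ (toPrincipalIdeal (𝓞 K) K).range

/-- The image of `P_ℚ` in `I_K`: the ideals `q 𝓞_K` with `q ∈ ℚˣ`. -/
def rationalPrincipalIdeals : Subgroup (FractionalIdeal (𝓞 K)⁰ K)ˣ :=
  ((toPrincipalIdeal (𝓞 K) K).comp (Units.map (algebraMap ℚ K : ℚ →* K))).range

/-- `P_K^G / P_ℚ`. -/
abbrev AmbiguousQuotient : Type _ :=
  principalAmbiguousIdeals K ⧸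
    (rationalPrincipalIdeals K).subgroupOf (principalAmbiguousIdeals K)

variable {K}

/-- The class of a principal ambiguous ideal in `P_K^G / P_ℚ`. -/
def AmbiguousQuotient.mk (A : principalAmbiguousIdeals K) : AmbiguousQuotient K :=
  QuotientGroup.mk A

/-- The principal ambiguous ideal `A`, viewed as a fractional ideal of `K`. -/
def principalAmbiguousIdeals.val (A : principalAmbiguousIdeals K) :
    FractionalIdeal (𝓞 K)⁰ K :=
  ((A : (FractionalIdeal (𝓞 K)⁰ K)ˣ) : FractionalIdeal (𝓞 K)⁰ K)

end Ideals

end CyclicCubic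

end

/-! Let `D` be the ideal generated by all `σ x - x`, for a nontrivial `σ`. It is supported on the
totally ramified primes, with exponent 1 away from 3 and exponent 2 at 3. The conductor has the same
factorization, so `D` has norm `c_K` (`absNorm_differenceIdeal`). An ideal whose norm involves only
totally ramified primes is determined by that norm, so `D` is the ideal `𝔠_K`.

The factorization of the conductor rests on the cubic case of Kronecker–Weber
(`exists_fieldRange_le_rootsField`). The cube of a Lagrange resolvent lies in `ℤ[ω]` and its norm is
a cube; such an element is built from units, cubes and factors `π² π̄`, whose cube roots are
cyclotomic: ninth roots of unity, Eisenstein integers and Gauss sums. This puts `K` in a cyclotomic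
field of level squarefree away from 3 and not divisible by 27. Inertia then removes the unramified
primes from the level.

If `𝓞 K = ℤ[γ]`, then `b = σ γ - γ` generates `𝔠_K`. It has trace 0, so the unit `e = σ b / b`
satisfies `1 + e + e σ(e) = 0` and is a Shanks root; exchanging `σ` and `σ²` turns `t` into `-3 -
t`, which secures `t ≥ -1`. This gives (i) and (a) ⇒ (b).

For (b) ⇒ (c), the relation `σ(θ - σ θ) = σ²θ (θ - σ θ)` and the equality of the classes of `θ` and
`σ²θ` make `θ - σ θ` a rational multiple of a generator of `𝔠_K`. For (c) ⇒ (d), norms are compared,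
using `N(θ - σ θ) = Δ_t` and the fact that `c_K` is cube-free. For (d) ⇒ (a), `θ - σ θ` is a unit
times `n β`. Hence `θ` is congruent to a rational integer `a` modulo `n`, and `g = (θ - a) / n` has
`g - σ g` generating `𝔠_K`. Divided differences then show `𝓞 K = ℤ[g]`
(`isMonogenic_of_span_sub_eq`). -/

noncomputable section

namespace CyclicCubic

/-! ### The cyclic group of order 3 acting on the ring of integers -/

section Galois

variable {K : Type*} [Field K] [NumberField K]

/-- The action of `σ` on the ring of integers. -/
def intGal (σ : K ≃ₐ[ℚ] K) : 𝓞 K ≃+* 𝓞 K := RingOfIntegers.mapRingEquiv (σ : K ≃+* K)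

@[simp] theorem coe_intGal (σ : K ≃ₐ[ℚ] K) (x : 𝓞 K) : ((intGal σ x : 𝓞 K) : K) = σ x := rfl

theorem intGal_mul_apply (σ τ : K ≃ₐ[ℚ] K) (x : 𝓞 K) :
    intGal (σ * τ) x = intGal σ (intGal τ x) := rfl

theorem eq_intCast_of_eq_ratCast {x : 𝓞 K} {q : ℚ} (h : (x : K) = q) :
    ∃ n : ℤ, x = n ∧ q = n := by
  have hx : IsIntegral ℤ (algebraMap ℚ K q) := by
    rw [eq_ratCast, ← h]; exact RingOfIntegers.isIntegral_coe x
  have hq : IsIntegral ℤ q := (isIntegral_algebraMap_iff (algebraMap ℚ K).injective).1 hx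
  obtain ⟨n, hn⟩ := IsIntegrallyClosed.isIntegral_iff.1 hq
  refine ⟨n, ?_, by simpa using hn.symm⟩
  apply RingOfIntegers.coe_injective
  refine h.trans ?_
  rw [← hn]; simp

variable [IsGalois ℚ K] (hK : Module.finrank ℚ K = 3)

include hK

theorem card_gal : Nat.card (K ≃ₐ[ℚ] K) = 3 := by
  rw [IsGalois.card_aut_eq_finrank, hK]

theorem isGaloisGenerator_of_ne_one {σ : K ≃ₐ[ℚ] K} (hσ : σ ≠ 1) : IsGaloisGenerator σ := by
  have : Fact (Nat.Prime 3) := ⟨Nat.prime_three⟩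
  exact zpowers_eq_top_of_prime_card (card_gal hK) hσ

theorem ne_one_of_isGaloisGenerator {σ : K ≃ₐ[ℚ] K} (hσ : IsGaloisGenerator σ) : σ ≠ 1 := by
  rintro rfl
  rw [IsGaloisGenerator, Subgroup.zpowers_one_eq_bot] at hσ
  have h3 := card_gal hK
  rw [← Subgroup.card_top, ← hσ, Subgroup.card_bot] at h3
  omega

theorem exists_ne_one : ∃ σ : K ≃ₐ[ℚ] K, σ ≠ 1 := by
  have : Nontrivial (K ≃ₐ[ℚ] K) := by
    rw [← Finite.one_lt_card_iff_nontrivial, card_gal hK]; omega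
  exact exists_ne 1

theorem gal_cube (σ : K ≃ₐ[ℚ] K) : σ ^ 3 = 1 := by
  rw [← card_gal hK]; exact pow_card_eq_one'

theorem gal_gal_gal (σ : K ≃ₐ[ℚ] K) (x : K) : σ (σ (σ x)) = x := by
  have := congrArg (fun τ : K ≃ₐ[ℚ] K => τ x) (gal_cube hK σ)
  simpa [pow_succ] using this

theorem intGal_intGal_intGal (σ : K ≃ₐ[ℚ] K) (x : 𝓞 K) :
    intGal σ (intGal σ (intGal σ x)) = x :=
  RingOfIntegers.coe_injective (gal_gal_gal hK σ x)

theorem gal_eq_one_or {σ : K ≃ₐ[ℚ] K} (hσ : σ ≠ 1) (τ : K ≃ₐ[ℚ] K) :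
    τ = 1 ∨ τ = σ ∨ τ = σ ^ 2 := by
  have hτ : τ ∈ Subgroup.zpowers σ := by
    rw [show Subgroup.zpowers σ = ⊤ from isGaloisGenerator_of_ne_one hK hσ]; trivial
  have ho : orderOf σ = 3 := orderOf_eq_prime (gal_cube hK σ) hσ
  classical
  rw [mem_zpowers_iff_mem_range_orderOf, ho] at hτ
  simp only [Finset.mem_image, Finset.mem_range] at hτ
  obtain ⟨k, hk, rfl⟩ := hτ
  interval_cases k <;> simp

theorem sq_ne_one {σ : K ≃ₐ[ℚ] K} (hσ : σ ≠ 1) : σ ^ 2 ≠ 1 := by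
  intro h
  apply hσ
  have := gal_cube hK σ
  rwa [pow_succ, h, one_mul] at this

theorem exists_rat_of_fixed {σ : K ≃ₐ[ℚ] K} (hσ : σ ≠ 1) {x : K} (hx : σ x = x) :
    ∃ q : ℚ, x = q := by
  have h : x ∈ (⊥ : IntermediateField ℚ K) := by
    rw [IsGalois.mem_bot_iff_fixed]
    intro τ
    rcases gal_eq_one_or hK hσ τ with rfl | rfl | rfl
    · rfl
    · exact hx
    · rw [pow_two, AlgEquiv.mul_apply, hx, hx]
  obtain ⟨q, hq⟩ := IntermediateField.mem_bot.1 h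
  exact ⟨q, by rw [← hq, eq_ratCast]⟩

theorem exists_int_of_fixed {σ : K ≃ₐ[ℚ] K} (hσ : σ ≠ 1) {x : 𝓞 K} (hx : intGal σ x = x) :
    ∃ n : ℤ, x = n := by
  obtain ⟨q, hq⟩ := exists_rat_of_fixed hK hσ (x := (x : K)) (by rw [← coe_intGal, hx])
  obtain ⟨n, hn, -⟩ := eq_intCast_of_eq_ratCast hq
  exact ⟨n, hn⟩

theorem exists_int_trace {σ : K ≃ₐ[ℚ] K} (hσ : σ ≠ 1) (x : 𝓞 K) :
    ∃ n : ℤ, x + intGal σ x + intGal σ (intGal σ x) = n := by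
  apply exists_int_of_fixed hK hσ
  rw [map_add, map_add, intGal_intGal_intGal hK]; ring

theorem norm_eq_mul_mul {σ : K ≃ₐ[ℚ] K} (hσ : σ ≠ 1) (x : K) :
    ((Algebra.norm ℚ x : ℚ) : K) = x * σ x * σ (σ x) := by
  classical
  rw [← eq_ratCast (algebraMap ℚ K), Algebra.norm_eq_prod_automorphisms]
  have huniv : (Finset.univ : Finset (K ≃ₐ[ℚ] K)) = {1, σ, σ ^ 2} := by
    ext τ; simpa using gal_eq_one_or hK hσ τ
  have h12 : σ ≠ σ ^ 2 := by
    intro h; apply hσ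
    have : σ * 1 = σ * σ := by rw [mul_one, ← pow_two, ← h]
    exact (mul_left_cancel this).symm
  change ∏ τ ∈ (Finset.univ : Finset (K ≃ₐ[ℚ] K)), τ x = _
  rw [huniv, Finset.prod_insert, Finset.prod_insert, Finset.prod_singleton]
  · simp [pow_two, mul_assoc]
  · simpa using h12
  · simp [hσ.symm, (sq_ne_one hK hσ).symm]

theorem intNorm_eq_mul_mul {σ : K ≃ₐ[ℚ] K} (hσ : σ ≠ 1) (x : 𝓞 K) :
    ((Algebra.norm ℤ x : ℤ) : 𝓞 K) = x * intGal σ x * intGal σ (intGal σ x) := by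
  apply RingOfIntegers.coe_injective
  have h := norm_eq_mul_mul hK hσ (x : K)
  rw [← Algebra.coe_norm_int] at h
  simpa using h

omit [IsGalois ℚ K] in
theorem absNorm_span_natCast (n : ℕ) : Ideal.absNorm (Ideal.span {(n : 𝓞 K)}) = n ^ 3 := by
  have : (n : 𝓞 K) = algebraMap ℤ (𝓞 K) n := by simp
  rw [Ideal.absNorm_span_singleton, this, Algebra.norm_algebraMap, RingOfIntegers.rank, hK]
  simp [Int.natAbs_pow]

/-- A finite-order automorphism congruent to `1` modulo a prime is trivial. -/
theorem exists_not_dvd_sub {σ : K ≃ₐ[ℚ] K} (hσ : σ ≠ 1) {p : ℕ} (hp : p.Prime) :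
    ∃ x : 𝓞 K, ¬ (p : 𝓞 K) ∣ intGal σ x - x := by
  by_contra! hall
  have hp0 : (p : 𝓞 K) ≠ 0 := by exact_mod_cast hp.ne_zero
  -- Write `σ y = y + p^(k+1) A y`. Expanding `σ³ = 1` gives `3 A + 3 p^(k+1) A² + p^(2k+2) A³ = 0`,
  -- which forces `p ∣ A x`; for `p = 3` one first cancels a factor 3.
  have hstep : ∀ k : ℕ, (∀ x : 𝓞 K, (p : 𝓞 K) ^ (k + 1) ∣ intGal σ x - x) →
      ∀ x : 𝓞 K, (p : 𝓞 K) ^ (k + 2) ∣ intGal σ x - x := by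
    intro k hk x
    choose A hA using hk
    have hs : ∀ y, intGal σ y = y + (p : 𝓞 K) ^ (k + 1) * A y := fun y => by rw [← hA]; ring
    have h1 : intGal σ (A x) = A x + (p : 𝓞 K) ^ (k + 1) * A (A x) := hs _
    have h2 : intGal σ (A (A x)) = A (A x) + (p : 𝓞 K) ^ (k + 1) * A (A (A x)) := hs _
    have hmap : ∀ y, intGal σ ((p : 𝓞 K) ^ (k + 1) * y) = (p : 𝓞 K) ^ (k + 1) * intGal σ y := by
      intro y; simp
    have h3 := intGal_intGal_intGal hK σ x
    rw [hs x, map_add, hs x, hmap, h1, map_add, map_add, hmap, hmap, map_add, hmap,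
      hs x, h1, h2] at h3
    have h4 : (p : 𝓞 K) ^ (k + 1) * (3 * A x + 3 * (p : 𝓞 K) ^ (k + 1) * A (A x)
        + (p : 𝓞 K) ^ (k + 1) * (p : 𝓞 K) ^ (k + 1) * A (A (A x))) = 0 := by
      linear_combination h3
    have h5 := (mul_eq_zero.1 h4).resolve_left (pow_ne_zero _ hp0)
    have hdiv : (p : 𝓞 K) ∣ A x := by
      by_cases hp3 : p = 3
      · subst hp3
        push_cast at h5
        refine ⟨-((3 : 𝓞 K) ^ k * A (A x) + 3 ^ k * 3 ^ k * A (A (A x))), ?_⟩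
        have h30 : (3 : 𝓞 K) ≠ 0 := by norm_num
        apply mul_left_cancel₀ h30
        push_cast
        linear_combination h5
      · have hco : IsCoprime (p : ℤ) 3 := by
          rw [show (3 : ℤ) = (3 : ℕ) by rfl, Nat.isCoprime_iff_coprime]
          exact (Nat.coprime_primes hp Nat.prime_three).2 hp3
        have hco' : IsCoprime (p : 𝓞 K) 3 := by
          simpa using hco.map (Int.castRingHom (𝓞 K))
        apply hco'.dvd_of_dvd_mul_left
        refine ⟨-((p : 𝓞 K) ^ k * (3 * A (A x) + (p : 𝓞 K) ^ (k + 1) * A (A (A x)))), ?_⟩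
        linear_combination h5
    rw [hA, pow_succ (p : 𝓞 K) (k + 1)]
    exact mul_dvd_mul_left _ hdiv
  have hpow : ∀ k : ℕ, ∀ x : 𝓞 K, (p : 𝓞 K) ^ (k + 1) ∣ intGal σ x - x := by
    intro k
    induction k with
    | zero => simpa using hall
    | succ k ih => exact hstep k ih
  -- Krull's intersection theorem: `σ x - x` lies in every power of `(p)`.
  have hfix : ∀ x : 𝓞 K, intGal σ x = x := by
    intro x
    have hne : Ideal.span {(p : 𝓞 K)} ≠ ⊤ := by
      intro h
      have := absNorm_span_natCast hK p
      rw [h, Ideal.absNorm_top] at this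
      exact hp.one_lt.ne ((Nat.pow_eq_one.1 this.symm).resolve_right (by norm_num)).symm
    have hinf := Ideal.iInf_pow_eq_bot_of_isDomain _ hne
    have : intGal σ x - x ∈ (⨅ i : ℕ, Ideal.span {(p : 𝓞 K)} ^ i) := by
      rw [Ideal.mem_iInf]
      intro i
      rw [Ideal.span_singleton_pow, Ideal.mem_span_singleton]
      exact (pow_dvd_pow _ (Nat.le_succ i)).trans (hpow i x)
    rw [hinf, Ideal.mem_bot] at this
    exact sub_eq_zero.1 this
  apply hσ
  ext x
  obtain ⟨a, b, -, rfl⟩ := IsFractionRing.div_surjective (A := 𝓞 K) x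
  rw [map_div₀]
  have ha := congrArg (fun y : 𝓞 K => (y : K)) (hfix a)
  have hb := congrArg (fun y : 𝓞 K => (y : K)) (hfix b)
  simp only [coe_intGal] at ha hb
  rw [ha, hb]; rfl

end Galois

/-! ### Total ramification and the local exponents of the difference ideal -/

section Ramification

variable {K : Type*} [Field K] [NumberField K]

/-- `P` is the totally ramified prime above `p` in a cubic field. -/
structure IsTotallyRamifiedAt (p : ℕ) (P : Ideal (𝓞 K)) : Prop where
  isPrime : P.IsPrime
  cube_eq : P ^ 3 = Ideal.span {(p : 𝓞 K)}

variable (K) in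
/-- The prime `p` is totally ramified in the cubic field `K`. -/
def IsTotallyRamified (p : ℕ) : Prop := ∃ P : Ideal (𝓞 K), IsTotallyRamifiedAt p P

theorem ne_bot_of_natCast_mem {p : ℕ} (hp : p ≠ 0) {Q : Ideal (𝓞 K)} (hpQ : (p : 𝓞 K) ∈ Q) :
    Q ≠ ⊥ := by
  rintro rfl
  rw [Ideal.mem_bot] at hpQ
  exact hp (by exact_mod_cast hpQ)

theorem natCast_dvd_of_mem {p : ℕ} (hp : p.Prime) {Q : Ideal (𝓞 K)} (hQ : Q ≠ ⊤)
    (hpQ : (p : 𝓞 K) ∈ Q) {n : ℤ} (hn : (n : 𝓞 K) ∈ Q) : (p : ℤ) ∣ n := by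
  by_contra h
  obtain ⟨a, b, hab⟩ := ((Nat.prime_iff_prime_int.1 hp).irreducible.coprime_iff_not_dvd).2 h
  apply hQ
  rw [Ideal.eq_top_iff_one]
  have : (1 : 𝓞 K) = (a : 𝓞 K) * p + b * n := by exact_mod_cast congrArg (Int.cast (R := 𝓞 K)) hab.symm
  rw [this]
  exact Q.add_mem (Q.mul_mem_left _ hpQ) (Q.mul_mem_left _ hn)

theorem exists_isPrime_of_dvd_absNorm {p : ℕ} (hp : p.Prime) {I : Ideal (𝓞 K)}
    (h : p ∣ Ideal.absNorm I) : ∃ Q : Ideal (𝓞 K), Q.IsPrime ∧ (p : 𝓞 K) ∈ Q ∧ I ≤ Q := by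
  obtain ⟨Q, hQ, hu, hdvd⟩ := Ideal.exists_isMaximal_dvd_of_dvd_absNorm' hp I h
  refine ⟨Q, hQ.isPrime, ?_, Ideal.le_of_dvd hdvd⟩
  have : (p : ℤ) ∈ Ideal.under ℤ Q := by rw [hu]; exact Ideal.mem_span_singleton_self _
  simpa [Ideal.mem_comap] using this

namespace IsTotallyRamifiedAt

variable {p : ℕ} {P : Ideal (𝓞 K)}

omit [NumberField K] in
theorem natCast_mem_cube (h : IsTotallyRamifiedAt p P) : (p : 𝓞 K) ∈ P ^ 3 := by
  rw [h.cube_eq]; exact Ideal.mem_span_singleton_self _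

omit [NumberField K] in
theorem natCast_mem (h : IsTotallyRamifiedAt p P) : (p : 𝓞 K) ∈ P :=
  Ideal.pow_le_self (by norm_num) h.natCast_mem_cube

theorem ne_bot (h : IsTotallyRamifiedAt p P) (hp : p.Prime) : P ≠ ⊥ :=
  ne_bot_of_natCast_mem hp.ne_zero h.natCast_mem

theorem eq_of_mem (h : IsTotallyRamifiedAt p P) (hp : p.Prime) {Q : Ideal (𝓞 K)} (hQ : Q.IsPrime)
    (hpQ : (p : 𝓞 K) ∈ Q) : Q = P := by
  have hle : P ≤ Q := by
    rw [← Ideal.IsPrime.pow_le_iff (n := 3) (by norm_num), h.cube_eq,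
      Ideal.span_singleton_le_iff_mem]
    exact hpQ
  exact ((h.isPrime.isMaximal (h.ne_bot hp)).eq_of_le hQ.ne_top hle).symm

theorem absNorm_eq (h : IsTotallyRamifiedAt p P) (hK : Module.finrank ℚ K = 3) :
    Ideal.absNorm P = p := by
  have h3 := absNorm_span_natCast hK p
  rw [← h.cube_eq, map_pow] at h3
  exact Nat.pow_left_injective (by norm_num : (3 : ℕ) ≠ 0) h3

/-- The residue field has `p` elements, so it is additively generated by 1. -/
theorem exists_int_sub_mem (h : IsTotallyRamifiedAt p P) (hK : Module.finrank ℚ K = 3)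
    (hp : p.Prime) (x : 𝓞 K) : ∃ n : ℤ, x - n ∈ P := by
  have : Fact p.Prime := ⟨hp⟩
  have hcard : Nat.card (𝓞 K ⧸ P) = p := by
    rw [← h.absNorm_eq hK, Ideal.absNorm_apply]; rfl
  have hne : (1 : 𝓞 K ⧸ P) ≠ 0 := by
    have := Ideal.Quotient.nontrivial_iff.2 h.isPrime.ne_top
    exact one_ne_zero
  have htop := zmultiples_eq_top_of_prime_card hcard hne
  have hx : Ideal.Quotient.mk P x ∈ AddSubgroup.zmultiples (1 : 𝓞 K ⧸ P) := by rw [htop]; trivial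
  obtain ⟨n, hn⟩ := AddSubgroup.mem_zmultiples_iff.1 hx
  refine ⟨n, ?_⟩
  rw [← Ideal.Quotient.eq_zero_iff_mem, map_sub, map_intCast, ← hn]
  simp

theorem intGal_mem_pow (h : IsTotallyRamifiedAt p P) (σ : K ≃ₐ[ℚ] K) (k : ℕ) {x : 𝓞 K}
    (hx : x ∈ P ^ k) : intGal σ x ∈ P ^ k := by
  have hle : P.map (intGal σ : 𝓞 K →+* 𝓞 K) ≤ P := by
    rw [Ideal.map_le_iff_le_comap]
    intro y hy
    rw [Ideal.mem_comap]
    apply h.isPrime.mem_of_pow_mem 3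
    have h3 : y ^ 3 ∈ P ^ 3 := Ideal.pow_mem_pow hy 3
    rw [h.cube_eq, Ideal.mem_span_singleton'] at h3
    obtain ⟨a, ha⟩ := h3
    have : (intGal σ : 𝓞 K →+* 𝓞 K) y ^ 3 = intGal σ a * p := by
      rw [← map_pow, ← ha]; simp
    rw [this]
    exact P.mul_mem_left _ h.natCast_mem
  have := Ideal.mem_map_of_mem (intGal σ : 𝓞 K →+* 𝓞 K) hx
  rw [Ideal.map_pow] at this
  exact Ideal.pow_right_mono hle k this

/-- Modulo `P` every element is a rational integer, which `σ` fixes: the whole Galois group is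
inertia. -/
theorem intGal_sub_mem (h : IsTotallyRamifiedAt p P) (hK : Module.finrank ℚ K = 3)
    (hp : p.Prime) (σ : K ≃ₐ[ℚ] K) (x : 𝓞 K) : intGal σ x - x ∈ P := by
  obtain ⟨n, hn⟩ := h.exists_int_sub_mem hK hp x
  have h1 := h.intGal_mem_pow σ 1 (x := x - n) (by simpa using hn)
  have : intGal σ x - x = intGal σ (x - n) - (x - n) := by simp
  rw [this]
  exact P.sub_mem (by simpa using h1) hn

theorem intCast_dvd (h : IsTotallyRamifiedAt p P) (hp : p.Prime) {n : ℤ} (hn : (n : 𝓞 K) ∈ P) :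
    (p : ℤ) ∣ n :=
  natCast_dvd_of_mem hp h.isPrime.ne_top h.natCast_mem hn

theorem intCast_mem_cube (h : IsTotallyRamifiedAt p P) (hp : p.Prime) {n : ℤ}
    (hn : (n : 𝓞 K) ∈ P) : (n : 𝓞 K) ∈ P ^ 3 := by
  obtain ⟨m, rfl⟩ := h.intCast_dvd hp hn
  push_cast
  exact Ideal.mul_mem_right _ _ h.natCast_mem_cube

variable [IsGalois ℚ K]

/-- Tame case. Were `σ` trivial modulo `P²`, the trace of a uniformizer `π` would be `3 π` modulo
`P²`. But that trace is a rational integer in `P`, hence lies in `P³`, and 3 is invertible modulo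
`P`. -/
theorem exists_intGal_sub_notMem_sq (h : IsTotallyRamifiedAt p P) (hK : Module.finrank ℚ K = 3)
    (hp : p.Prime) (hp3 : p ≠ 3) {σ : K ≃ₐ[ℚ] K} (hσ : σ ≠ 1) :
    ∃ x : 𝓞 K, intGal σ x - x ∉ P ^ 2 := by
  by_contra! hall
  obtain ⟨π, hπ, hπ2⟩ := Ideal.exists_mem_pow_notMem_pow_succ P (h.ne_bot hp) h.isPrime.ne_top 1
  apply hπ2
  obtain ⟨n, hn⟩ := exists_int_trace hK hσ π
  have hnP : (n : 𝓞 K) ∈ P := by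
    rw [← hn]
    have h1 := h.intGal_mem_pow σ 1 hπ
    have h2 := h.intGal_mem_pow σ 1 h1
    rw [pow_one] at hπ h1 h2
    exact P.add_mem (P.add_mem hπ h1) h2
  have hn2 : (n : 𝓞 K) ∈ P ^ 2 := Ideal.pow_le_pow_right (by norm_num) (h.intCast_mem_cube hp hnP)
  have h3 : (3 : 𝓞 K) * π ∈ P ^ 2 := by
    have : (3 : 𝓞 K) * π = n - (intGal σ (intGal σ π) - intGal σ π)
        - 2 * (intGal σ π - π) := by rw [← hn]; ring
    rw [this]
    exact (P ^ 2).sub_mem ((P ^ 2).sub_mem hn2 (hall _)) ((P ^ 2).mul_mem_left _ (hall _))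
  obtain ⟨a, b, hab⟩ : IsCoprime (p : ℤ) 3 := by
    rw [show (3 : ℤ) = (3 : ℕ) by rfl, Nat.isCoprime_iff_coprime]
    exact (Nat.coprime_primes hp Nat.prime_three).2 hp3
  have hab' : (a : 𝓞 K) * p + b * 3 = 1 := by exact_mod_cast congrArg (Int.cast (R := 𝓞 K)) hab
  have : π = a * π * p + b * (3 * π) := by linear_combination (-π) * hab'
  rw [show 1 + 1 = 2 from rfl, this]
  exact (P ^ 2).add_mem ((P ^ 2).mul_mem_left _
    (Ideal.pow_le_pow_right (by norm_num) h.natCast_mem_cube)) ((P ^ 2).mul_mem_left _ h3)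

/-- Wild case. Here `σ π ≡ u π` modulo `P²` with `u³ ≡ 1`, and in characteristic 3 this forces `u ≡
1`; every element is `n + m π` modulo `P²` with integers `n`, `m`. -/
theorem intGal_sub_mem_sq (h : IsTotallyRamifiedAt 3 P) (hK : Module.finrank ℚ K = 3)
    (σ : K ≃ₐ[ℚ] K) (x : 𝓞 K) : intGal σ x - x ∈ P ^ 2 := by
  have hp := Nat.prime_three
  obtain ⟨π, hπ, hπ2⟩ := Ideal.exists_mem_pow_notMem_pow_succ P (h.ne_bot hp) h.isPrime.ne_top 1
  have := h.isPrime
  rw [show 1 + 1 = 2 from rfl] at hπ2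
  have hlin : ∀ y ∈ P, ∃ m : ℤ, y - m * π ∈ P ^ 2 := by
    intro y hy
    obtain ⟨d, e, he, hde⟩ := Ideal.exists_mul_add_mem_pow_succ (h.ne_bot hp) π y hπ hπ2
      (by simpa using hy)
    obtain ⟨m, hm⟩ := h.exists_int_sub_mem hK hp d
    refine ⟨m, ?_⟩
    have : y - m * π = π * (d - m) + e := by rw [← hde]; ring
    rw [this]
    refine (P ^ 2).add_mem ?_ he
    rw [pow_two]
    exact Ideal.mul_mem_mul (by simpa using hπ) hm
  have hπP : π ∈ P := by simpa using hπ
  have hσP : ∀ y ∈ P, intGal σ y ∈ P := fun y hy => by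
    simpa using h.intGal_mem_pow σ 1 (by simpa using hy)
  obtain ⟨u, hu⟩ := hlin _ (hσP π hπP)
  have hu3 : (u : 𝓞 K) - 1 ∈ P := by
    have e1 := h.intGal_mem_pow σ 2 hu
    have e2 := h.intGal_mem_pow σ 2 e1
    simp only [map_sub, map_mul, map_intCast, intGal_intGal_intGal hK] at e1 e2
    have e3 : ((u : 𝓞 K) ^ 3 - 1) * π ∈ P ^ 2 := by
      have : ((u : 𝓞 K) ^ 3 - 1) * π = -((π - u * intGal σ (intGal σ π)) +
        u * (intGal σ (intGal σ π) - u * intGal σ π) + u ^ 2 * (intGal σ π - u * π)) := by ring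
      rw [this]
      exact (P ^ 2).neg_mem ((P ^ 2).add_mem ((P ^ 2).add_mem e2 ((P ^ 2).mul_mem_left _ e1))
        ((P ^ 2).mul_mem_left _ hu))
    have e4 : (u : 𝓞 K) ^ 3 - 1 ∈ P := by
      rw [mul_comm] at e3
      exact (h.isPrime.mem_pow_mul P e3).resolve_left hπ2
    apply h.isPrime.mem_of_pow_mem 3
    have h3 : (3 : 𝓞 K) ∈ P := by simpa using h.natCast_mem
    have : ((u : 𝓞 K) - 1) ^ 3 = (u ^ 3 - 1) - 3 * (u ^ 2 - u) := by ring
    rw [this]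
    exact P.sub_mem e4 (P.mul_mem_right _ h3)
  have hππ : intGal σ π - π ∈ P ^ 2 := by
    have : intGal σ π - π = (intGal σ π - u * π) + (u - 1) * π := by ring
    rw [this]
    refine (P ^ 2).add_mem hu ?_
    rw [pow_two]
    exact Ideal.mul_mem_mul hu3 hπP
  obtain ⟨n, hn⟩ := h.exists_int_sub_mem hK hp x
  obtain ⟨m, hm⟩ := hlin _ hn
  have hm' := h.intGal_mem_pow σ 2 hm
  have : intGal σ x - x = intGal σ (x - n - m * π) - (x - n - m * π) + m * (intGal σ π - π) := by
    simp only [map_sub, map_mul, map_intCast]; ring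
  rw [this]
  exact (P ^ 2).add_mem ((P ^ 2).sub_mem hm' hm) ((P ^ 2).mul_mem_left _ hππ)

theorem exists_intGal_sub_notMem_cube (h : IsTotallyRamifiedAt p P)
    (hK : Module.finrank ℚ K = 3) (hp : p.Prime) {σ : K ≃ₐ[ℚ] K} (hσ : σ ≠ 1) :
    ∃ x : 𝓞 K, intGal σ x - x ∉ P ^ 3 := by
  obtain ⟨x, hx⟩ := exists_not_dvd_sub hK hσ hp
  exact ⟨x, by rwa [h.cube_eq, Ideal.mem_span_singleton]⟩

end IsTotallyRamifiedAt

variable [IsGalois ℚ K]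

/-- A prime with nontrivial inertia is totally ramified. -/
theorem isTotallyRamified_of_forall_intGal_sub_mem (hK : Module.finrank ℚ K = 3) {p : ℕ}
    (hp : p.Prime) {σ : K ≃ₐ[ℚ] K} (hσ : σ ≠ 1) {Q : Ideal (𝓞 K)} (hQ : Q.IsPrime)
    (hpQ : (p : 𝓞 K) ∈ Q) (hall : ∀ x : 𝓞 K, intGal σ x - x ∈ Q) : IsTotallyRamified K p := by
  have hmem : ∀ x : 𝓞 K, intGal σ x ∈ Q → x ∈ Q := by
    intro x hx
    have := Q.sub_mem hx (hall x)
    simpa using this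
  -- For `x` in another prime `Q'` above `p`, the norm of `x` is divisible by `p`, so a conjugate of
  -- `x` lies in `Q`; since `σ` is trivial modulo `Q`, so does `x`.
  have huniq : ∀ Q' : Ideal (𝓞 K), Q'.IsPrime → (p : 𝓞 K) ∈ Q' → Q' = Q := by
    intro Q' hQ' hpQ'
    refine (hQ'.isMaximal (ne_bot_of_natCast_mem hp.ne_zero hpQ')).eq_of_le hQ.ne_top ?_
    intro x hx
    have hN : ((Algebra.norm ℤ x : ℤ) : 𝓞 K) ∈ Q' := by
      rw [intNorm_eq_mul_mul hK hσ, mul_assoc]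
      exact Q'.mul_mem_right _ hx
    obtain ⟨m, hm⟩ := natCast_dvd_of_mem hp hQ'.ne_top hpQ' hN
    have hN2 : x * intGal σ x * intGal σ (intGal σ x) ∈ Q := by
      rw [← intNorm_eq_mul_mul hK hσ, hm]
      push_cast
      exact Q.mul_mem_right _ hpQ
    rcases hQ.mem_or_mem hN2 with h | h
    · rcases hQ.mem_or_mem h with h | h
      · exact h
      · exact hmem _ h
    · exact hmem _ (hmem _ h)
  have hp0 : Ideal.span {(p : 𝓞 K)} ≠ ⊥ :=
    ne_bot_of_natCast_mem hp.ne_zero (Ideal.mem_span_singleton_self _)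
  obtain ⟨e, he⟩ : ∃ e : ℕ, Q ^ e = Ideal.span {(p : 𝓞 K)} := by
    classical
    refine ⟨(UniqueFactorizationMonoid.normalizedFactors (Ideal.span {(p : 𝓞 K)})).card, ?_⟩
    rw [← Multiset.prod_replicate, ← Multiset.eq_replicate.2 ⟨rfl, ?_⟩,
      Ideal.prod_normalizedFactors_eq_self hp0]
    intro Q' hQ'
    obtain ⟨h1, h2⟩ := (Ideal.mem_normalizedFactors_iff hp0).1 hQ'
    exact huniq Q' h1 (h2 (Ideal.mem_span_singleton_self _))
  have hnorm := absNorm_span_natCast hK p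
  rw [← he, map_pow] at hnorm
  have he0 : e ≠ 0 := by
    rintro rfl
    rw [pow_zero] at hnorm
    have := hp.one_lt
    exact absurd hnorm.symm (Nat.one_lt_pow (by norm_num) this).ne'
  obtain ⟨j, -, hj⟩ := (Nat.dvd_prime_pow hp).1 (hnorm ▸ dvd_pow_self (Ideal.absNorm Q) he0)
  rw [hj, ← pow_mul] at hnorm
  have hje := Nat.pow_right_injective hp.two_le hnorm
  -- The norm of `Q ^ e = (p)` is `p³`, so `e` divides 3. If `e = 1`, then `σ` would be trivial
  -- modulo `p`.
  rcases (Nat.dvd_prime Nat.prime_three).1 ⟨j, by rw [mul_comm]; exact hje.symm⟩ with rfl | rfl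
  · exfalso
    obtain ⟨x, hx⟩ := exists_not_dvd_sub hK hσ hp
    apply hx
    rw [← Ideal.mem_span_singleton, ← he, pow_one]
    exact hall x
  · exact ⟨Q, hQ, he⟩

/-- The ideal generated by the differences `σ x - x`. -/
def differenceIdeal (σ : K ≃ₐ[ℚ] K) : Ideal (𝓞 K) :=
  Ideal.span (Set.range fun x : 𝓞 K => intGal σ x - x)

omit [IsGalois ℚ K] in
theorem differenceIdeal_le_iff {σ : K ≃ₐ[ℚ] K} {I : Ideal (𝓞 K)} :
    differenceIdeal σ ≤ I ↔ ∀ x : 𝓞 K, intGal σ x - x ∈ I := by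
  rw [differenceIdeal, Ideal.span_le, Set.range_subset_iff]; rfl

theorem differenceIdeal_ne_bot (hK : Module.finrank ℚ K = 3) {σ : K ≃ₐ[ℚ] K} (hσ : σ ≠ 1) :
    differenceIdeal σ ≠ ⊥ := by
  intro h
  obtain ⟨x, hx⟩ := exists_not_dvd_sub hK hσ Nat.prime_two
  apply hx
  have := differenceIdeal_le_iff.1 h.le x
  rw [Ideal.mem_bot] at this
  rw [this]; exact dvd_zero _

-- As `P` is the only prime above `p`, the cofactor of `P ^ k` in `I` has norm prime to `p`.
omit [IsGalois ℚ K] in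
theorem factorization_absNorm_eq (hK : Module.finrank ℚ K = 3) {p : ℕ} (hp : p.Prime)
    {P : Ideal (𝓞 K)} (h : IsTotallyRamifiedAt p P) {I : Ideal (𝓞 K)} (hI : I ≠ ⊥) {k : ℕ}
    (hle : I ≤ P ^ k) (hnle : ¬ I ≤ P ^ (k + 1)) : (Ideal.absNorm I).factorization p = k := by
  obtain ⟨J, rfl⟩ := Ideal.dvd_iff_le.2 hle
  have hJ0 : J ≠ ⊥ := by rintro rfl; exact hI (by simp)
  have hJ : ¬ p ∣ Ideal.absNorm J := by
    intro hd
    obtain ⟨Q, hQ, hpQ, hJQ⟩ := exists_isPrime_of_dvd_absNorm hp hd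
    rw [h.eq_of_mem hp hQ hpQ] at hJQ
    exact hnle (by rw [pow_succ]; exact Ideal.mul_mono_right hJQ)
  have hJn : Ideal.absNorm J ≠ 0 := by rwa [Ne, Ideal.absNorm_eq_zero_iff]
  rw [map_mul, map_pow, h.absNorm_eq hK, Nat.factorization_mul (pow_ne_zero _ hp.ne_zero) hJn,
    Finsupp.add_apply, Nat.factorization_eq_zero_of_not_dvd hJ, Nat.Prime.factorization_pow hp]
  simp

theorem factorization_absNorm_differenceIdeal_of_ne_three (hK : Module.finrank ℚ K = 3) {p : ℕ}
    (hp : p.Prime) (hp3 : p ≠ 3) (hr : IsTotallyRamified K p) {σ : K ≃ₐ[ℚ] K} (hσ : σ ≠ 1) :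
    (Ideal.absNorm (differenceIdeal σ)).factorization p = 1 := by
  obtain ⟨P, h⟩ := hr
  refine factorization_absNorm_eq hK hp h (differenceIdeal_ne_bot hK hσ) ?_ ?_
  · rw [pow_one, differenceIdeal_le_iff]; exact h.intGal_sub_mem hK hp σ
  · rw [differenceIdeal_le_iff]; push Not; exact h.exists_intGal_sub_notMem_sq hK hp hp3 hσ

theorem factorization_absNorm_differenceIdeal_three (hK : Module.finrank ℚ K = 3)
    (hr : IsTotallyRamified K 3) {σ : K ≃ₐ[ℚ] K} (hσ : σ ≠ 1) :
    (Ideal.absNorm (differenceIdeal σ)).factorization 3 = 2 := by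
  obtain ⟨P, h⟩ := hr
  refine factorization_absNorm_eq hK Nat.prime_three h (differenceIdeal_ne_bot hK hσ) ?_ ?_
  · rw [differenceIdeal_le_iff]; exact h.intGal_sub_mem_sq hK σ
  · rw [differenceIdeal_le_iff]; push Not
    exact h.exists_intGal_sub_notMem_cube hK Nat.prime_three hσ

theorem factorization_absNorm_differenceIdeal_of_not (hK : Module.finrank ℚ K = 3) {p : ℕ}
    (hp : p.Prime) (hr : ¬ IsTotallyRamified K p) {σ : K ≃ₐ[ℚ] K} (hσ : σ ≠ 1) :
    (Ideal.absNorm (differenceIdeal σ)).factorization p = 0 := by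
  apply Nat.factorization_eq_zero_of_not_dvd
  intro hd
  obtain ⟨Q, hQ, hpQ, hle⟩ := exists_isPrime_of_dvd_absNorm hp hd
  exact hr (isTotallyRamified_of_forall_intGal_sub_mem hK hp hσ hQ hpQ
    (differenceIdeal_le_iff.1 hle))

omit [IsGalois ℚ K] in
/-- An ideal whose norm is a product of totally ramified primes is determined by its norm. -/
theorem ideal_eq_of_absNorm_eq (hK : Module.finrank ℚ K = 3) (n : ℕ) :
    n ≠ 0 → (∀ p : ℕ, p.Prime → p ∣ n → IsTotallyRamified K p) → ∀ I J : Ideal (𝓞 K),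
      Ideal.absNorm I = n → Ideal.absNorm J = n → I = J := by
  induction n using Nat.strong_induction_on with
  | _ n ih =>
    intro hn hram I J hI hJ
    rcases eq_or_ne n 1 with rfl | hn1
    · rw [Ideal.absNorm_eq_one_iff] at hI hJ
      rw [hI, hJ]
    · obtain ⟨p, hp, hpn⟩ := Nat.exists_prime_and_dvd hn1
      obtain ⟨P, h⟩ := hram p hp hpn
      -- Any ideal whose norm is divisible by `p` is contained in a prime above `p`, which can only
      -- be `P`; peel it off and induct.
      have key : ∀ I : Ideal (𝓞 K), Ideal.absNorm I = n →
          ∃ I' : Ideal (𝓞 K), I = P * I' ∧ p * Ideal.absNorm I' = n := by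
        intro I hI
        obtain ⟨Q, hQ, hpQ, hle⟩ := exists_isPrime_of_dvd_absNorm hp (hI.symm ▸ hpn)
        rw [h.eq_of_mem hp hQ hpQ] at hle
        obtain ⟨I', rfl⟩ := Ideal.dvd_iff_le.2 hle
        refine ⟨I', rfl, ?_⟩
        rw [← hI, map_mul, h.absNorm_eq hK]
      obtain ⟨I', rfl, hI'⟩ := key I hI
      obtain ⟨J', rfl, hJ'⟩ := key J hJ
      have heq : Ideal.absNorm J' = Ideal.absNorm I' :=
        Nat.eq_of_mul_eq_mul_left hp.pos (hJ'.trans hI'.symm)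
      have h0 : Ideal.absNorm I' ≠ 0 := by
        intro h0; rw [h0, mul_zero] at hI'; exact hn hI'.symm
      rw [ih (Ideal.absNorm I') ?_ h0 ?_ I' J' rfl heq]
      · rw [← hI']
        exact lt_mul_of_one_lt_left (Nat.pos_of_ne_zero h0) hp.one_lt
      · intro q hq hqd
        exact hram q hq (hI' ▸ hqd.mul_left p)

end Ramification

/-! ### Inertia in cyclotomic fields and the level of a cubic subfield -/

section Cyclotomic

/-- If `h` fixes the `p ^ k`-th power of a primitive root of unity, it lies in the inertia group of
every prime above `p`. -/
theorem intGal_sub_mem_of_fixes_pow {L : Type*} [Field L] [NumberField L] {M : ℕ} [NeZero M]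
    [IsCyclotomicExtension {M} ℚ L] {ζ : L} (hζ : IsPrimitiveRoot ζ M) {p k : ℕ} (hp : p.Prime)
    (h : L ≃ₐ[ℚ] L) (hfix : h (ζ ^ p ^ k) = ζ ^ p ^ k) {P : Ideal (𝓞 L)} (hP : P.IsPrime)
    (hpP : (p : 𝓞 L) ∈ P) (y : 𝓞 L) : intGal h y - y ∈ P := by
  have : Fact p.Prime := ⟨hp⟩
  have hchar : CharP (𝓞 L ⧸ P) p := by
    have := Ideal.Quotient.nontrivial_iff.2 hP.ne_top
    refine (CharP.charP_iff_prime_eq_zero hp).2 ?_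
    rw [← map_natCast (Ideal.Quotient.mk P)]
    exact Ideal.Quotient.eq_zero_iff_mem.2 hpP
  let f : 𝓞 L →ₐ[ℤ] 𝓞 L ⧸ P :=
    ((Ideal.Quotient.mk P).comp (intGal h : 𝓞 L →+* 𝓞 L)).toIntAlgHom
  let g : 𝓞 L →ₐ[ℤ] 𝓞 L ⧸ P := (Ideal.Quotient.mk P).toIntAlgHom
  have hz : intGal h hζ.toInteger ^ p ^ k = hζ.toInteger ^ p ^ k := by
    apply RingOfIntegers.coe_injective
    rw [map_pow] at hfix
    exact hfix
  have hfg : f = g := by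
    apply AlgHom.ext_of_adjoin_eq_top (IsCyclotomicExtension.Rat.adjoin_singleton_eq_top hζ)
    rintro _ rfl
    change Ideal.Quotient.mk P (intGal h hζ.toInteger) = Ideal.Quotient.mk P hζ.toInteger
    rw [← sub_eq_zero]
    -- Raising to the power `p ^ k` is additive in characteristic `p`, so the difference of the two
    -- images of `ζ` is nilpotent in a domain.
    apply eq_zero_of_pow_eq_zero (n := p ^ k)
    rw [sub_pow_char_pow, ← map_pow, hz, ← map_pow, sub_self]
  rw [← Ideal.Quotient.eq_zero_iff_mem, map_sub, sub_eq_zero]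
  exact DFunLike.congr_fun hfg y

theorem nonempty_algHom_of_fieldRange_le {F K L C : Type*} [Field F] [Field K] [Field L] [Field C]
    [Algebra F K] [Algebra F L] [Algebra F C] [Algebra.IsIntegral F L] {m : ℕ} [NeZero m]
    [IsCyclotomicExtension {m} F C] {η : L} (hη : IsPrimitiveRoot η m)
    (φ : K →ₐ[F] L) (hle : φ.fieldRange ≤ F⟮η⟯) : Nonempty (K →ₐ[F] C) := by
  have := hη.intermediateField_adjoin_isCyclotomicExtension F
  let e : F⟮η⟯ ≃ₐ[F] C := IsCyclotomicExtension.algEquiv {m} F _ _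
  exact ⟨e.toAlgHom.comp ((IntermediateField.inclusion hle).comp φ.rangeRestrict)⟩

/-- `CyclotomicField m ℚ` is cyclotomic over `ℚ`, for the canonical `ℚ`-algebra structure. -/
theorem isCyclotomicExtension_cyclotomicField (m : ℕ) [NeZero m] :
    IsCyclotomicExtension {m} ℚ (CyclotomicField m ℚ) :=
  CyclotomicField.isCyclotomicExtension m ℚ

theorem exists_isMaximal_liesOver (L : Type*) [Field L] [NumberField L] {p : ℕ} (hp : p.Prime) :
    ∃ P : Ideal (𝓞 L), P.IsMaximal ∧ P.LiesOver (Ideal.span {(p : ℤ)}) := by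
  have hp0 : Ideal.span {(p : ℤ)} ≠ ⊥ := by simpa using hp.ne_zero
  have hmax : (Ideal.span {(p : ℤ)}).IsMaximal :=
    ((Ideal.span_singleton_prime (by exact_mod_cast hp.ne_zero)).2
      (Nat.prime_iff_prime_int.1 hp)).isMaximal hp0
  exact Ideal.exists_maximal_ideal_liesOver_of_isIntegral _

theorem natCast_mem_of_liesOver {L : Type*} [Field L] {p : ℕ} (P : Ideal (𝓞 L))
    [hlo : P.LiesOver (Ideal.span {(p : ℤ)})] : (p : 𝓞 L) ∈ P := by
  have : (p : ℤ) ∈ Ideal.under ℤ P := by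
    rw [← hlo.over]; exact Ideal.mem_span_singleton_self _
  simpa [Ideal.mem_comap] using this

variable {K : Type*} [Field K] [NumberField K] [IsGalois ℚ K]

/-- Primes that are not ramified can be removed from the level of a cyclotomic field
containing `K`. -/
theorem nonempty_algHom_cyclotomicField_of_not_ramified (hK : Module.finrank ℚ K = 3) {p k m : ℕ}
    (hp : p.Prime) (hm : m ≠ 0) (hram : ¬ IsTotallyRamified K p)
    (h : Nonempty (K →ₐ[ℚ] CyclotomicField (p ^ k * m) ℚ)) :
    Nonempty (K →ₐ[ℚ] CyclotomicField m ℚ) := by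
  obtain ⟨φ⟩ := h
  have : NeZero m := ⟨hm⟩
  have hM : p ^ k * m ≠ 0 := mul_ne_zero (pow_ne_zero _ hp.ne_zero) hm
  have : NeZero (p ^ k * m) := ⟨hM⟩
  have := isCyclotomicExtension_cyclotomicField m
  have := isCyclotomicExtension_cyclotomicField (p ^ k * m)
  set L := CyclotomicField (p ^ k * m) ℚ with hL
  have : NumberField L := IsCyclotomicExtension.numberField {p ^ k * m} ℚ L
  have : IsGalois ℚ L := IsCyclotomicExtension.isGalois {p ^ k * m} ℚ L
  have hζ := IsCyclotomicExtension.zeta_spec (p ^ k * m) ℚ L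
  set ζ := IsCyclotomicExtension.zeta (p ^ k * m) ℚ L
  have hη : IsPrimitiveRoot (ζ ^ p ^ k) m := hζ.pow (Nat.pos_of_ne_zero hM) rfl
  refine nonempty_algHom_of_fieldRange_le hη φ ?_
  let := φ.toRingHom.toAlgebra
  have : IsScalarTower ℚ K L := IsScalarTower.of_algebraMap_eq fun x => (φ.commutes x).symm
  rintro _ ⟨x, rfl⟩
  rw [← IsGalois.fixedField_fixingSubgroup ℚ⟮ζ ^ p ^ k⟯, IntermediateField.mem_fixedField_iff]
  intro τ hτ
  have hfix : τ (ζ ^ p ^ k) = ζ ^ p ^ k :=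
    (IntermediateField.mem_fixingSubgroup_iff _ _).1 hτ _
      (IntermediateField.mem_adjoin_simple_self ℚ _)
  have hcomm : ∀ y : K, φ (τ.restrictNormal K y) = τ (φ y) := fun y =>
    AlgEquiv.restrictNormal_commutes τ K y
  -- The restriction of `τ` to `K` is trivial modulo a prime above `p`; if it were not the identity,
  -- `p` would be totally ramified.
  suffices hone : τ.restrictNormal K = 1 by
    have := hcomm x
    rw [hone] at this
    exact this.symm
  by_contra hne
  apply hram
  obtain ⟨P, hP, hlo⟩ := exists_isMaximal_liesOver L hp
  have hpP : (p : 𝓞 L) ∈ P := natCast_mem_of_liesOver P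
  let f : 𝓞 K →+* 𝓞 L := algebraMap (𝓞 K) (𝓞 L)
  have hPp := hP.isPrime
  refine isTotallyRamified_of_forall_intGal_sub_mem hK hp hne (Q := P.comap f)
    (Ideal.IsPrime.comap f) ?_ ?_
  · rw [Ideal.mem_comap, map_natCast]; exact hpP
  · intro y
    rw [Ideal.mem_comap]
    have h1 := intGal_sub_mem_of_fixes_pow hζ hp τ hfix hPp hpP (f y)
    convert h1 using 1
    rw [map_sub]
    congr 1
    apply RingOfIntegers.coe_injective
    exact hcomm y

omit [IsGalois ℚ K] in
theorem three_le_ramificationIdx {p : ℕ} (hp : p.Prime) (hram : IsTotallyRamified K p)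
    {L : Type*} [Field L] [NumberField L] (φ : K →ₐ[ℚ] L) (P : Ideal (𝓞 L)) [hP : P.IsPrime]
    [hlo : P.LiesOver (Ideal.span {(p : ℤ)})] : 3 ≤ P.ramificationIdx ℤ := by
  let := φ.toRingHom.toAlgebra
  have hpP : (p : 𝓞 L) ∈ P := natCast_mem_of_liesOver P
  obtain ⟨𝔭, h𝔭⟩ := hram
  let f : 𝓞 K →+* 𝓞 L := algebraMap (𝓞 K) (𝓞 L)
  have h𝔭P : 𝔭.map f ≤ P := by
    rw [Ideal.map_le_iff_le_comap, ← h𝔭.eq_of_mem hp (Ideal.IsPrime.comap f)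
      (by rw [Ideal.mem_comap, map_natCast]; exact hpP)]
  have hmap : (Ideal.span {(p : ℤ)}).map (algebraMap ℤ (𝓞 L)) = 𝔭.map f ^ 3 := by
    rw [← Ideal.map_pow, h𝔭.cube_eq, Ideal.map_span, Ideal.map_span]
    simp
  have hmap0 : (Ideal.span {(p : ℤ)}).map (algebraMap ℤ (𝓞 L)) ≠ ⊥ := by
    refine ne_bot_of_natCast_mem hp.ne_zero ?_
    simpa using Ideal.mem_map_of_mem (algebraMap ℤ (𝓞 L)) (Ideal.mem_span_singleton_self (p : ℤ))
  rw [Ideal.IsDedekindDomain.ramificationIdx_eq_multiplicity (Ideal.span {(p : ℤ)}) P hmap0]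
  have hfin : FiniteMultiplicity P ((Ideal.span {(p : ℤ)}).map (algebraMap ℤ (𝓞 L))) :=
    FiniteMultiplicity.of_prime_left
      (Ideal.prime_of_isPrime (ne_bot_of_natCast_mem hp.ne_zero hpP) hP) hmap0
  apply hfin.le_multiplicity_of_pow_dvd
  rw [hmap]
  exact pow_dvd_pow_of_dvd (Ideal.dvd_iff_le.2 h𝔭P) 3

-- The ramification index of `p` in the `m`-th cyclotomic field is 1 if `p ∤ m`, and is 2 if `p = 3`
-- divides `m` exactly once; both are below 3.
omit [IsGalois ℚ K] in
theorem dvd_of_isTotallyRamified {p : ℕ} (hp : p.Prime) (hram : IsTotallyRamified K p) {m : ℕ}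
    (hm : m ≠ 0) (φ : K →ₐ[ℚ] CyclotomicField m ℚ) : p ∣ m ∧ (p = 3 → 9 ∣ m) := by
  have : NeZero m := ⟨hm⟩
  have : Fact p.Prime := ⟨hp⟩
  have := isCyclotomicExtension_cyclotomicField m
  have : NumberField (CyclotomicField m ℚ) := IsCyclotomicExtension.numberField {m} ℚ _
  obtain ⟨P, hP, hlo⟩ := exists_isMaximal_liesOver (CyclotomicField m ℚ) hp
  have hPp := hP.isPrime
  have h3 := three_le_ramificationIdx hp hram φ P
  have hdvd : p ∣ m := by
    by_contra hno
    rw [IsCyclotomicExtension.Rat.ramificationIdx_eq_of_not_dvd p (CyclotomicField m ℚ) P hno] at h3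
    omega
  refine ⟨hdvd, ?_⟩
  rintro rfl
  by_contra hno
  obtain ⟨n, rfl⟩ := hdvd
  have hn : ¬ 3 ∣ n := fun h => hno (by obtain ⟨j, rfl⟩ := h; exact ⟨j, by ring⟩)
  rw [IsCyclotomicExtension.Rat.ramificationIdx_eq (3 * n) (k := 0)
    (CyclotomicField (3 * n) ℚ) P (by ring) hn] at h3
  omega

end Cyclotomic

/-! ### Arithmetic of the Eisenstein integers -/

section Eisenstein

/-- A presentation of `R` as the ring of Eisenstein integers with its conjugation. -/
structure EisensteinData (R : Type*) [CommRing R] where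
  /-- the cube root of unity -/
  ω : R
  sq_add : ω ^ 2 + ω + 1 = 0
  exists_eq : ∀ x : R, ∃ a b : ℤ, x = a + b * ω
  /-- the conjugation -/
  conj : R ≃+* R
  conj_ω : conj ω = ω ^ 2

namespace EisensteinData

variable {R : Type*} [CommRing R] (E : EisensteinData R)

theorem ω_cube : E.ω ^ 3 = 1 := by
  linear_combination (E.ω - 1) * E.sq_add

theorem conj_conj (x : R) : E.conj (E.conj x) = x := by
  obtain ⟨a, b, rfl⟩ := E.exists_eq x
  simp only [map_add, map_mul, map_intCast, E.conj_ω, map_pow]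
  linear_combination (b : R) * E.ω * E.ω_cube

theorem mul_conj (a b : ℤ) :
    (a + b * E.ω : R) * E.conj (a + b * E.ω) = ((a ^ 2 - a * b + b ^ 2 : ℤ) : R) := by
  simp only [map_add, map_mul, map_intCast, E.conj_ω]
  push_cast
  linear_combination (a * b : R) * E.sq_add + (b : R) ^ 2 * E.ω_cube

theorem exists_norm (x : R) : ∃ n : ℕ, x * E.conj x = n := by
  obtain ⟨a, b, rfl⟩ := E.exists_eq x
  have h : 0 ≤ a ^ 2 - a * b + b ^ 2 := by nlinarith [sq_nonneg (a - b), sq_nonneg (a + b)]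
  refine ⟨(a ^ 2 - a * b + b ^ 2).toNat, ?_⟩
  rw [E.mul_conj, ← Int.cast_natCast (R := R), Int.toNat_of_nonneg h]

theorem conj_dvd_conj {x y : R} (h : x ∣ y) : E.conj x ∣ E.conj y := map_dvd E.conj h

theorem conj_dvd_iff {x y : R} : E.conj x ∣ y ↔ x ∣ E.conj y :=
  ⟨fun h => by simpa [E.conj_conj] using E.conj_dvd_conj h,
    fun h => by simpa [E.conj_conj] using E.conj_dvd_conj h⟩

theorem isUnit_of_mul_conj_eq_one {x : R} (h : x * E.conj x = 1) : IsUnit x :=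
  IsUnit.of_mul_eq_one _ h

variable [CharZero R]

include E in
theorem natCast_dvd {m n : ℕ} (h : (m : R) ∣ n) : m ∣ n := by
  obtain ⟨x, hx⟩ := h
  obtain ⟨k, hk⟩ := E.exists_norm x
  have h2 : (n : R) * E.conj n = (m : R) ^ 2 * k := by
    rw [hx, ← hk, map_mul, map_natCast]; ring
  rw [map_natCast, ← pow_two] at h2
  have h3 : n ^ 2 = m ^ 2 * k := by exact_mod_cast h2
  exact (Nat.pow_dvd_pow_iff two_ne_zero).1 ⟨k, h3⟩

theorem norm_eq_one_of_isUnit {x : R} (h : IsUnit x) : x * E.conj x = 1 := by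
  obtain ⟨n, hn⟩ := E.exists_norm x
  have hu : IsUnit (n : R) := hn ▸ h.mul (h.map E.conj)
  have : n ∣ 1 := E.natCast_dvd (by rw [Nat.cast_one]; exact hu.dvd)
  rw [hn, Nat.dvd_one.1 this, Nat.cast_one]

theorem isUnit_eq {u : R} (h : IsUnit u) : ∃ k : ℕ, u = E.ω ^ k ∨ u = -E.ω ^ k := by
  have h1 := E.norm_eq_one_of_isUnit h
  obtain ⟨a, b, rfl⟩ := E.exists_eq u
  rw [E.mul_conj] at h1
  have h2 : a ^ 2 - a * b + b ^ 2 = 1 := by exact_mod_cast h1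
  -- Four times the norm form is `(a - 2b)² + 3a²`, and symmetrically in `b`.
  have ha : a ^ 2 ≤ 1 := by nlinarith [sq_nonneg (a - 2 * b)]
  have hb : b ^ 2 ≤ 1 := by nlinarith [sq_nonneg (2 * a - b)]
  have ha1 : -1 ≤ a := by nlinarith
  have ha2 : a ≤ 1 := by nlinarith
  have hb1 : -1 ≤ b := by nlinarith
  have hb2 : b ≤ 1 := by nlinarith
  have hsq : E.ω ^ 2 = -1 - E.ω := by linear_combination E.sq_add
  have hcases : (a = 1 ∧ b = 0) ∨ (a = -1 ∧ b = 0) ∨ (a = 0 ∧ b = 1) ∨ (a = 0 ∧ b = -1) ∨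
      (a = 1 ∧ b = 1) ∨ (a = -1 ∧ b = -1) := by
    interval_cases a <;> interval_cases b <;> simp_all
  rcases hcases with ⟨rfl, rfl⟩ | ⟨rfl, rfl⟩ | ⟨rfl, rfl⟩ | ⟨rfl, rfl⟩ | ⟨rfl, rfl⟩ | ⟨rfl, rfl⟩
  · exact ⟨0, Or.inl (by simp)⟩
  · exact ⟨0, Or.inr (by simp)⟩
  · exact ⟨1, Or.inl (by simp)⟩
  · exact ⟨1, Or.inr (by simp)⟩
  · exact ⟨2, Or.inr (by rw [hsq]; push_cast; ring)⟩
  · exact ⟨2, Or.inl (by rw [hsq]; push_cast; ring)⟩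

omit [CharZero R] in
theorem prime_conj {π : R} (h : Prime π) : Prime (E.conj π) :=
  (MulEquiv.prime_iff E.conj.toMulEquiv).2 h

omit [CharZero R] in
theorem exists_prime_dvd_natCast {π : R} (h : Prime π) (n : ℕ) (hn : n ≠ 0) (hd : π ∣ (n : R)) :
    ∃ p : ℕ, p.Prime ∧ π ∣ (p : R) := by
  induction n using Nat.recOnMul with
  | zero => exact absurd rfl hn
  | one => rw [Nat.cast_one] at hd; exact absurd (isUnit_of_dvd_one hd) h.not_isUnit
  | prime p hp => exact ⟨p, hp, hd⟩
  | mul a b iha ihb =>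
    rw [Nat.cast_mul] at hd
    rcases h.dvd_or_dvd hd with h1 | h1
    · exact iha (left_ne_zero_of_mul hn) h1
    · exact ihb (right_ne_zero_of_mul hn) h1

variable [IsDomain R]

/-- A prime not associated to its conjugate has as norm a prime `p` congruent to `1` mod `3`. -/
theorem norm_of_not_dvd_conj {π : R} (h : Prime π) (hna : ¬ π ∣ E.conj π) :
    ∃ p : ℕ, p.Prime ∧ p % 3 = 1 ∧ π * E.conj π = p := by
  obtain ⟨q, hq⟩ := E.exists_norm π
  have hq0 : q ≠ 0 := by
    rintro rfl
    rw [Nat.cast_zero, mul_eq_zero] at hq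
    exact hq.elim h.ne_zero (E.prime_conj h).ne_zero
  obtain ⟨p, hp, hπp⟩ := exists_prime_dvd_natCast h q hq0 ⟨_, hq.symm⟩
  have hcp : E.conj π ∣ (p : R) := by simpa using E.conj_dvd_conj hπp
  -- `π` and its conjugate are non-associated primes dividing `p`, so their product `q` divides `p`.
  have hqp : q ∣ p := by
    apply E.natCast_dvd
    rw [← hq]
    obtain ⟨c, hc⟩ := hπp
    rw [hc] at hcp ⊢
    refine mul_dvd_mul_left π (((E.prime_conj h).dvd_or_dvd hcp).resolve_left ?_)
    intro hd
    exact hna (E.conj_dvd_iff.1 hd)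
  have hq1 : q ≠ 1 := by
    rintro rfl
    exact h.not_isUnit (E.isUnit_of_mul_conj_eq_one (by simpa using hq))
  obtain rfl : q = p := ((Nat.dvd_prime hp).1 hqp).resolve_left hq1
  refine ⟨q, hp, ?_, hq⟩
  obtain ⟨a, b, rfl⟩ := E.exists_eq π
  have hab : a ^ 2 - a * b + b ^ 2 = (q : ℤ) := by
    have := E.mul_conj a b
    rw [hq] at this
    exact_mod_cast this.symm
  -- The norm is `(a + b)² - 3ab`. If `3 ∣ a + b` it equals 3, and then it divides the square of the
  -- conjugate of `π`, so `π` divides its conjugate; otherwise it is 1 modulo 3.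
  by_cases h3 : (3 : ℤ) ∣ a + b
  · exfalso
    obtain ⟨c, hc⟩ := h3
    obtain rfl : a = 3 * c - b := by linarith
    have hq3 : 3 ∣ q := by
      have : (3 : ℤ) ∣ q := ⟨3 * c ^ 2 - 3 * c * b + b ^ 2, by rw [← hab]; ring⟩
      exact_mod_cast this
    obtain rfl : 3 = q := (Nat.prime_dvd_prime_iff_eq Nat.prime_three hp).1 hq3
    apply hna
    have hsq : (((3 * c - b : ℤ) : R) + b * E.ω) * E.conj (((3 * c - b : ℤ) : R) + b * E.ω) ∣
        E.conj (((3 * c - b : ℤ) : R) + b * E.ω) * E.conj (((3 * c - b : ℤ) : R) + b * E.ω) := by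
      rw [hq]
      refine ⟨((3 * c - b) * (c - b) : ℤ) + (b * (b - 2 * c) : ℤ) * E.ω, ?_⟩
      simp only [map_add, map_mul, map_intCast, E.conj_ω]
      have h4 : E.ω ^ 2 = -1 - E.ω := by linear_combination E.sq_add
      rw [h4]
      push_cast
      linear_combination (b : R) ^ 2 * E.sq_add
    exact (mul_dvd_mul_iff_right (E.prime_conj h).ne_zero).1 hsq
  · have h1 : (q : ℤ) % 3 = 1 := by
      rw [← hab]
      have : a ^ 2 - a * b + b ^ 2 = (a + b) ^ 2 - 3 * (a * b) := by ring
      rw [this, Int.sub_mul_emod_self_left]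
      have h5 : (a + b) % 3 = 1 ∨ (a + b) % 3 = 2 := by omega
      rcases h5 with h5 | h5 <;> rw [pow_two, Int.mul_emod, h5] <;> rfl
    omega

end EisensteinData

/-- The ring of integers of the third cyclotomic field is a ring of Eisenstein integers. -/
theorem exists_eisensteinData (F : Type*) [Field F] [NumberField F]
    [IsCyclotomicExtension {3} ℚ F] : Nonempty (EisensteinData (𝓞 F)) := by
  have hζ := IsCyclotomicExtension.zeta_spec 3 ℚ F
  set ζ := IsCyclotomicExtension.zeta 3 ℚ F
  have hirr : Irreducible (Polynomial.cyclotomic 3 ℚ) :=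
    Polynomial.cyclotomic.irreducible_rat (by norm_num)
  have hζ2 : IsPrimitiveRoot (ζ ^ 2) 3 := hζ.pow_of_coprime 2 (by norm_num)
  let τ : F ≃ₐ[ℚ] F := IsCyclotomicExtension.fromZetaAut hζ2 hirr
  have hτ : τ ζ = ζ ^ 2 := IsCyclotomicExtension.fromZetaAut_spec hζ2 hirr
  have hI := hζ.toInteger_isPrimitiveRoot
  have hsq : hζ.toInteger ^ 2 + hζ.toInteger + 1 = 0 := by
    have h3 := hI.pow_eq_one
    have hne : hζ.toInteger - 1 ≠ 0 := sub_ne_zero.2 (hI.ne_one (by norm_num))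
    apply mul_left_cancel₀ hne
    linear_combination h3
  refine ⟨⟨hζ.toInteger, hsq, ?_, intGal τ, ?_⟩⟩
  · intro x
    have hx : x ∈ Algebra.adjoin ℤ {hζ.toInteger} := by
      rw [IsCyclotomicExtension.Rat.adjoin_singleton_eq_top hζ]; trivial
    induction hx using Algebra.adjoin_induction with
    | mem x hx => rw [Set.mem_singleton_iff] at hx; exact ⟨0, 1, by simp [hx]⟩
    | algebraMap n => exact ⟨n, 0, by simp⟩
    | add x y _ _ hx hy =>
      obtain ⟨a, b, rfl⟩ := hx
      obtain ⟨c, d, rfl⟩ := hy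
      exact ⟨a + c, b + d, by push_cast; ring⟩
    | mul x y _ _ hx hy =>
      obtain ⟨a, b, rfl⟩ := hx
      obtain ⟨c, d, rfl⟩ := hy
      refine ⟨a * c - b * d, a * d + b * c - b * d, ?_⟩
      push_cast
      linear_combination (b * d : 𝓞 F) * hsq
  · exact RingOfIntegers.coe_injective hτ

end Eisenstein

/-! ### Elements with cyclotomic cube roots; Gauss and Jacobi sums -/

section CubeRoots

/-- The field generated by the `M`-th roots of unity. -/
def rootsField (Ω : Type*) [Field Ω] [CharZero Ω] (M : ℕ) : IntermediateField ℚ Ω :=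
  IntermediateField.adjoin ℚ {x : Ω | x ^ M = 1}

/-- `M` is the product of a squarefree number prime to `3` and of `1`, `3` or `9`. -/
structure IsAdmissible (M : ℕ) : Prop where
  ne_zero : M ≠ 0
  eq_three : ∀ p : ℕ, p.Prime → p ^ 2 ∣ M → p = 3
  not_dvd : ¬ 27 ∣ M

theorem prime_pow_dvd_of_dvd_lcm {p : ℕ} (hp : p.Prime) {k a b : ℕ} (ha : a ≠ 0) (hb : b ≠ 0)
    (h : p ^ k ∣ Nat.lcm a b) : p ^ k ∣ a ∨ p ^ k ∣ b := by
  rw [hp.pow_dvd_iff_le_factorization (Nat.lcm_ne_zero ha hb), Nat.factorization_lcm ha hb,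
    Finsupp.sup_apply, le_sup_iff] at h
  rwa [hp.pow_dvd_iff_le_factorization ha, hp.pow_dvd_iff_le_factorization hb]

namespace IsAdmissible

theorem lcm {a b : ℕ} (ha : IsAdmissible a) (hb : IsAdmissible b) : IsAdmissible (Nat.lcm a b) := by
  refine ⟨Nat.lcm_ne_zero ha.ne_zero hb.ne_zero, fun p hp hd => ?_, fun hd => ?_⟩
  · exact (prime_pow_dvd_of_dvd_lcm hp ha.ne_zero hb.ne_zero hd).elim (ha.eq_three p hp)
      (hb.eq_three p hp)
  · exact (prime_pow_dvd_of_dvd_lcm (k := 3) Nat.prime_three ha.ne_zero hb.ne_zero hd).elim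
      ha.not_dvd hb.not_dvd

theorem of_dvd {a b : ℕ} (hb : IsAdmissible b) (h : a ∣ b) : IsAdmissible a :=
  ⟨fun h0 => hb.ne_zero (by rw [h0, zero_dvd_iff] at h; exact h),
    fun p hp hd => hb.eq_three p hp (hd.trans h), fun hd => hb.not_dvd (hd.trans h)⟩

theorem nine : IsAdmissible 9 := by
  refine ⟨by norm_num, fun p hp hd => ?_, by norm_num⟩
  have : p ∣ 3 ^ 2 := (dvd_pow_self p two_ne_zero).trans hd
  exact (Nat.prime_dvd_prime_iff_eq hp Nat.prime_three).1 (hp.dvd_of_dvd_pow this)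

theorem prime {p : ℕ} (hp : p.Prime) : IsAdmissible p := by
  have hsq : ∀ q : ℕ, q.Prime → ¬ q ^ 2 ∣ p := by
    intro q hq hd
    obtain rfl : q = p :=
      (Nat.prime_dvd_prime_iff_eq hq hp).1 ((dvd_pow_self q two_ne_zero).trans hd)
    have := Nat.le_of_dvd hq.pos hd
    nlinarith [hq.two_le]
  exact ⟨hp.ne_zero, fun q hq hd => (hsq q hq hd).elim,
    fun hd => hsq 3 Nat.prime_three (Dvd.dvd.trans (by norm_num) hd)⟩

end IsAdmissible

variable {Ω : Type*} [Field Ω] [CharZero Ω]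

theorem mem_rootsField {M : ℕ} {x : Ω} (hx : x ^ M = 1) : x ∈ rootsField Ω M :=
  IntermediateField.subset_adjoin ℚ _ hx

theorem rootsField_mono {M N : ℕ} (h : M ∣ N) : rootsField Ω M ≤ rootsField Ω N := by
  refine IntermediateField.adjoin.mono ℚ _ _ ?_
  obtain ⟨k, rfl⟩ := h
  intro x hx
  simp only [Set.mem_ofPred_eq] at hx ⊢
  rw [pow_mul, hx, one_pow]

theorem rootsField_le_adjoin {M : ℕ} (hM : M ≠ 0) {η : Ω} (hη : IsPrimitiveRoot η M) :
    rootsField Ω M ≤ ℚ⟮η⟯ := by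
  rw [rootsField, IntermediateField.adjoin_le_iff]
  intro x hx
  have : NeZero M := ⟨hM⟩
  obtain ⟨i, -, rfl⟩ := hη.eq_pow_of_pow_eq_one hx
  exact pow_mem (IntermediateField.mem_adjoin_simple_self ℚ η) i

variable {R : Type*} [CommRing R]

/-- The image of `α` has a cube root in a cyclotomic field of admissible level. -/
def HasCyclotomicCubeRoot (ι : R →+* Ω) (α : R) : Prop :=
  ∃ M : ℕ, IsAdmissible M ∧ ∃ s ∈ rootsField Ω M, s ^ 3 = ι α

namespace HasCyclotomicCubeRoot

variable {ι : R →+* Ω} {α β : R}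

theorem mul (ha : HasCyclotomicCubeRoot ι α) (hb : HasCyclotomicCubeRoot ι β) :
    HasCyclotomicCubeRoot ι (α * β) := by
  obtain ⟨M, hM, s, hs, hsα⟩ := ha
  obtain ⟨N, hN, t, ht, htβ⟩ := hb
  refine ⟨_, hM.lcm hN, s * t, mul_mem (rootsField_mono (Nat.dvd_lcm_left M N) hs)
    (rootsField_mono (Nat.dvd_lcm_right M N) ht), ?_⟩
  rw [mul_pow, hsα, htβ, map_mul]

theorem of_mem {M : ℕ} (hM : IsAdmissible M) (hα : ι α ∈ rootsField Ω M) :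
    HasCyclotomicCubeRoot ι (α ^ 3) :=
  ⟨M, hM, ι α, hα, (map_pow ι α 3).symm⟩

end HasCyclotomicCubeRoot

variable (E : EisensteinData R) (ι : R →+* Ω)

include E in
theorem map_mem_rootsField_three (x : R) : ι x ∈ rootsField Ω 3 := by
  obtain ⟨a, b, rfl⟩ := E.exists_eq x
  rw [map_add, map_mul, map_intCast, map_intCast]
  refine add_mem (intCast_mem _ a) (mul_mem (intCast_mem _ b) (mem_rootsField ?_))
  rw [← map_pow, E.ω_cube, map_one]

include E in
theorem HasCyclotomicCubeRoot.cube (x : R) : HasCyclotomicCubeRoot ι (x ^ 3) :=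
  .of_mem (.prime Nat.prime_three) (map_mem_rootsField_three E ι x)

-- Units are `± ω ^ k`, and a cube root of `ω` is a ninth root of unity. This is why level 9 must be
-- admissible.
include E in
theorem HasCyclotomicCubeRoot.unit [CharZero R] [IsAlgClosed Ω] {u : R} (hu : IsUnit u) :
    HasCyclotomicCubeRoot ι u := by
  obtain ⟨z, hz⟩ := IsAlgClosed.exists_pow_nat_eq (ι E.ω) (n := 3) (by norm_num)
  have hz9 : z ∈ rootsField Ω 9 := by
    apply mem_rootsField
    rw [show 9 = 3 * 3 from rfl, pow_mul, hz, ← map_pow, E.ω_cube, map_one]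
  obtain ⟨k, rfl | rfl⟩ := E.isUnit_eq hu
  · refine ⟨9, .nine, z ^ k, pow_mem hz9 k, ?_⟩
    rw [map_pow, ← hz]; ring
  · refine ⟨9, .nine, -z ^ k, neg_mem (pow_mem hz9 k), ?_⟩
    rw [map_neg, map_pow, ← hz]; ring

/-- Jacobi sums of cubic characters, and their cube roots as Gauss sums. -/
theorem exists_jacobi [IsDomain R] [CharZero R] [IsAlgClosed Ω] (hι : Function.Injective ι) {p : ℕ}
    (hp : p.Prime) (hp3 : p % 3 = 1) : ∃ J : R, J * E.conj J = p ∧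
      HasCyclotomicCubeRoot ι (J ^ 2 * E.conj J) ∧ HasCyclotomicCubeRoot ι (E.conj J ^ 2 * J) := by
  have : Fact p.Prime := ⟨hp⟩
  have hω3 : IsPrimitiveRoot E.ω 3 := by
    have hne : E.ω ≠ 1 := by
      intro h
      have := E.sq_add
      rw [h] at this
      norm_num at this
    exact (orderOf_eq_prime E.ω_cube hne) ▸ IsPrimitiveRoot.orderOf E.ω
  have hdvd : 3 ∣ Fintype.card (ZMod p) - 1 := by rw [ZMod.card]; omega
  obtain ⟨χ, hχ⟩ := MulChar.exists_mulChar_orderOf (ZMod p) hdvd hω3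
  have hχ3 : χ ^ 3 = 1 := by rw [← hχ]; exact pow_orderOf_eq_one χ
  have hχ1 : χ ≠ 1 := by rintro rfl; simp at hχ
  let χ' := χ.ringHomComp ι
  have hχ'3 : χ' ^ 3 = 1 := by
    rw [MulChar.ringHomComp_pow, hχ3, MulChar.ringHomComp_one]
  have hχ'1 : χ' ≠ 1 := (MulChar.ringHomComp_ne_one_iff hι).2 hχ1
  have : Fact (Nat.Prime 3) := ⟨Nat.prime_three⟩
  have hχ'o : orderOf χ' = 3 := orderOf_eq_prime hχ'3 hχ'1
  obtain ⟨ζ, hζ⟩ := HasEnoughRootsOfUnity.exists_primitiveRoot Ω p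
  have hψ := AddChar.zmodChar_primitive_of_primitive_root p hζ
  set ψ := AddChar.zmodChar p ((IsPrimitiveRoot.iff_def ζ p).mp hζ).left with hψdef
  have hval : ∀ a : ZMod p, IsUnit a → χ a ^ 3 = 1 := by
    intro a ha
    rw [← MulChar.pow_apply' _ (by norm_num), hχ3, MulChar.one_apply ha]
  -- The cube of the Gauss sum is `χ(-1) p J(χ, χ)`, and a cubic character takes the value 1 at -1.
  have hg3 : gaussSum χ' ψ ^ 3 = ι (p * jacobiSum χ χ) := by
    have h := gaussSum_pow_eq_prod_jacobiSum (χ := χ') (by rw [hχ'o]; norm_num) hψ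
    have hneg : χ' (-1) = 1 := by
      have h1 := hval (-1) isUnit_one.neg
      rw [← map_pow] at h1
      have h2 : ((-1 : ZMod p)) ^ 3 = -1 := by ring
      rw [h2] at h1
      change ι (χ (-1)) = 1
      rw [h1, map_one]
    rw [hχ'o, hneg, ZMod.card, show 3 - 1 = 1 + 1 from rfl, Nat.Ico_succ_singleton,
      Finset.prod_singleton, pow_one, jacobiSum_ringHomComp] at h
    rw [h]; simp
  have hconj : χ.ringHomComp (E.conj : R →+* R) = χ⁻¹ := by
    rw [eq_inv_iff_mul_eq_one]
    ext a
    rw [MulChar.mul_apply, MulChar.one_apply_coe]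
    obtain ⟨k, -, hk⟩ := hω3.eq_pow_of_pow_eq_one (hval a a.isUnit)
    change E.conj (χ a) * χ a = 1
    rw [← hk, map_pow, E.conj_ω]
    calc (E.ω ^ 2) ^ k * E.ω ^ k = (E.ω ^ 3) ^ k := by ring
      _ = 1 := by rw [E.ω_cube, one_pow]
  have hJ : jacobiSum χ χ * E.conj (jacobiSum χ χ) = p := by
    have h1 : E.conj (jacobiSum χ χ) = jacobiSum χ⁻¹ χ⁻¹ := by
      rw [← hconj]; exact (jacobiSum_ringHomComp χ χ (E.conj : R →+* R)).symm
    have hχχ : χ' * χ' ≠ 1 := by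
      intro h
      rw [pow_succ, pow_two, h, one_mul] at hχ'3
      exact hχ'1 hχ'3
    have hchar : ringChar Ω ≠ ringChar (ZMod p) := by
      rw [ringChar.eq Ω 0, ZMod.ringChar_zmod_n]; exact hp.ne_zero.symm
    have h2 := jacobiSum_mul_jacobiSum_inv hchar hχ'1 hχ'1 hχχ
    rw [show χ'⁻¹ = χ⁻¹.ringHomComp ι from MulChar.ringHomComp_inv χ ι, jacobiSum_ringHomComp, jacobiSum_ringHomComp, ← map_mul,
      ZMod.card, ← map_natCast ι] at h2
    rw [h1]
    exact hι h2
  have hadm := (IsAdmissible.prime Nat.prime_three).lcm (IsAdmissible.prime hp)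
  have hgmem : gaussSum χ' ψ ∈ rootsField Ω (Nat.lcm 3 p) := by
    refine sum_mem fun a _ => mul_mem ?_ ?_
    · exact rootsField_mono (Nat.dvd_lcm_left 3 p) (map_mem_rootsField_three E ι _)
    · refine rootsField_mono (Nat.dvd_lcm_right 3 p) (mem_rootsField ?_)
      rw [hψdef, AddChar.zmodChar_apply, ← pow_mul, mul_comm, pow_mul, hζ.pow_eq_one, one_pow]
  set J := jacobiSum χ χ
  have hpJ : (p : R) * J = J ^ 2 * E.conj J := by rw [← hJ]; ring
  rw [hpJ] at hg3
  have hp0 : (p : Ω) ≠ 0 := Nat.cast_ne_zero.2 hp.ne_zero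
  have hprod : ι (J ^ 2 * E.conj J) * ι (E.conj J ^ 2 * J) = (p : Ω) ^ 3 := by
    rw [← map_mul, ← map_natCast ι, ← hJ, ← map_pow ι]; congr 1; ring
  -- `J² J̄` and `J̄² J` have product `p³`, so a cube root of the second is `p` divided by the Gauss
  -- sum.
  refine ⟨J, hJ, ⟨_, hadm, _, hgmem, hg3⟩, ⟨_, hadm, p / gaussSum χ' ψ,
    div_mem (natCast_mem _ p) hgmem, ?_⟩⟩
  rw [div_pow, hg3, ← hprod, mul_div_cancel_left₀]
  intro h0
  rw [h0, zero_mul] at hprod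
  exact pow_ne_zero 3 hp0 hprod.symm

end CubeRoots

/-! ### Kronecker–Weber for cyclic cubic fields -/

section KroneckerWeber

variable {Ω : Type*} [Field Ω] [CharZero Ω] [IsAlgClosed Ω]
variable {R : Type*} [CommRing R] [IsDomain R] [CharZero R] (E : EisensteinData R)
variable {ι : R →+* Ω} (hι : Function.Injective ι)

include hι

/-- Since `π` divides `p = J J̄`, it is associated to `J` or to `J̄`, so the Gauss sum supplies the
cube root up to that of a unit. -/
theorem hasCyclotomicCubeRoot_sq_mul_conj {π : R} (hπ : Prime π) (hna : ¬ π ∣ E.conj π) :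
    HasCyclotomicCubeRoot ι (π ^ 2 * E.conj π) := by
  obtain ⟨p, hp, hp3, hpπ⟩ := E.norm_of_not_dvd_conj hπ hna
  obtain ⟨J, hJ, h1, h2⟩ := exists_jacobi E ι hι hp hp3
  have hp0 : (p : R) ≠ 0 := Nat.cast_ne_zero.2 hp.ne_zero
  have key : ∀ I : R, I * E.conj I = p → HasCyclotomicCubeRoot ι (I ^ 2 * E.conj I) → π ∣ I →
      HasCyclotomicCubeRoot ι (π ^ 2 * E.conj π) := by
    rintro _ hI hgood ⟨u, rfl⟩
    have hu : u * E.conj u = 1 := by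
      apply mul_left_cancel₀ hp0
      rw [mul_one]
      nth_rewrite 1 [← hpπ]
      rw [← hI, map_mul]; ring
    have hv : IsUnit (E.conj u) := IsUnit.of_mul_eq_one u (by rw [mul_comm]; exact hu)
    have hmul := hgood.mul (HasCyclotomicCubeRoot.unit E ι
      ((hv.pow 2).mul (E.isUnit_of_mul_conj_eq_one hu)))
    have : π ^ 2 * E.conj π = (π * u) ^ 2 * E.conj (π * u) * (E.conj u ^ 2 * u) := by
      rw [map_mul]
      linear_combination (-π ^ 2 * E.conj π * ((u * E.conj u) ^ 2 + u * E.conj u + 1)) * hu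
    rwa [this]
  have hdvd : π ∣ J * E.conj J := by rw [hJ, ← hpπ]; exact dvd_mul_right _ _
  rcases hπ.dvd_or_dvd hdvd with h | h
  · exact key J hJ h1 h
  · refine key (E.conj J) (by rw [E.conj_conj, mul_comm, hJ]) ?_ h
    rwa [E.conj_conj]

/-- Induction on `n`: a nonunit `α` with cube norm is divisible by some `ρ³`, or by some `ρ² ρ̄`
with `ρ` not dividing `ρ̄`, where `ρ` is prime. Such a factor has cube norm and a known cube root,
and is split off. -/
theorem hasCyclotomicCubeRoot_of_norm_eq_cube [IsPrincipalIdealRing R] (n : ℕ) :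
    ∀ α : R, α ≠ 0 → α * E.conj α = (n : R) ^ 3 → HasCyclotomicCubeRoot ι α := by
  induction n using Nat.strong_induction_on with
  | _ n ih =>
    intro α hα hn
    by_cases hu : IsUnit α
    · exact .unit E ι hu
    have hn0 : (n : R) ≠ 0 := by
      intro h0
      rw [h0, zero_pow (by norm_num), mul_eq_zero] at hn
      exact hn.elim hα (fun h => hα (by simpa using h))
    have hstep : ∀ γ : R, ¬ IsUnit γ → (∃ q : ℕ, γ * E.conj γ = (q : R) ^ 3) →
        HasCyclotomicCubeRoot ι γ → γ ∣ α → HasCyclotomicCubeRoot ι α := by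
      rintro γ hγu ⟨q, hq⟩ hγ ⟨β, rfl⟩
      have h1 : (q : R) ^ 3 * (β * E.conj β) = (n : R) ^ 3 := by
        rw [← hq, ← hn, map_mul]; ring
      have hqn : q ∣ n := by
        have : q ^ 3 ∣ n ^ 3 := E.natCast_dvd (by push_cast; exact ⟨_, h1.symm⟩)
        exact (Nat.pow_dvd_pow_iff (by norm_num)).1 this
      obtain ⟨m, rfl⟩ := hqn
      have hq0 : (q : R) ≠ 0 := fun h => hn0 (by rw [Nat.cast_mul, h, zero_mul])
      have h2 : β * E.conj β = (m : R) ^ 3 := by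
        apply mul_left_cancel₀ (pow_ne_zero 3 hq0)
        rw [h1]; push_cast; ring
      refine hγ.mul (ih m ?_ β (right_ne_zero_of_mul hα) h2)
      have hm0 : m ≠ 0 := by rintro rfl; exact hn0 (by simp)
      have hq1 : q ≠ 1 := by
        rintro rfl
        exact hγu (E.isUnit_of_mul_conj_eq_one (by simpa using hq))
      have hq0' : q ≠ 0 := by rintro rfl; exact hq0 (by simp)
      exact lt_mul_of_one_lt_left (Nat.pos_of_ne_zero hm0) (by omega)
    obtain ⟨π, hirr, hπα⟩ := WfDvdMonoid.exists_irreducible_factor hu hα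
    have hπ : Prime π := hirr.prime
    by_cases hcube : ∃ ρ : R, Prime ρ ∧ ρ ^ 3 ∣ α
    · obtain ⟨ρ, hρ, hd⟩ := hcube
      obtain ⟨q, hq⟩ := E.exists_norm ρ
      refine hstep (ρ ^ 3) (fun h => hρ.not_isUnit ((isUnit_pow_iff (by norm_num)).1 h))
        ⟨q, ?_⟩ (.cube E ι ρ) hd
      rw [map_pow, ← mul_pow, hq]
    push Not at hcube
    have hgood : ∀ ρ : R, Prime ρ → ¬ ρ ∣ E.conj ρ → ρ ^ 2 * E.conj ρ ∣ α →
        HasCyclotomicCubeRoot ι α := by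
      intro ρ hρ hna hd
      obtain ⟨p, -, -, hp⟩ := E.norm_of_not_dvd_conj hρ hna
      refine hstep _ ?_ ⟨p, ?_⟩ (hasCyclotomicCubeRoot_sq_mul_conj E hι hρ hna) hd
      · intro h
        exact hρ.not_isUnit (isUnit_of_dvd_unit (dvd_mul_of_dvd_left (dvd_pow_self _ two_ne_zero) _) h)
      · rw [map_mul, map_pow, E.conj_conj, ← hp]; ring
    have hcπ := EisensteinData.prime_conj E hπ
    have hπn : π ∣ (n : R) := by
      apply hπ.dvd_of_dvd_pow (n := 3)
      rw [← hn]; exact hπα.mul_right _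
    obtain ⟨n', hn'⟩ := hπn
    by_cases hsq : π ^ 2 ∣ α
    · obtain ⟨β, rfl⟩ := hsq
      have hβ : ¬ π ∣ β := by
        rintro ⟨γ, rfl⟩
        exact hcube π hπ ⟨γ, by ring⟩
      have h1 : β * E.conj (π ^ 2 * β) = π * n' ^ 3 := by
        apply mul_left_cancel₀ (pow_ne_zero 2 hπ.ne_zero)
        rw [← mul_assoc, hn, hn']; ring
      have h2 : π ∣ E.conj (π ^ 2 * β) :=
        (hπ.dvd_or_dvd (h1 ▸ dvd_mul_right _ _)).resolve_left hβ
      -- If `π` were associated to its conjugate, it would divide the norm of `α` exactly 4 times,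
      -- which is impossible for a cube. Otherwise `π̄` divides `β`, so `π² π̄` divides `α`.
      by_cases hna : π ∣ E.conj π
      · exfalso
        obtain ⟨u, hu⟩ := hna
        have hcβ : ¬ π ∣ E.conj β := by
          intro h
          have h3 : E.conj π ∣ β := E.conj_dvd_iff.2 h
          have h4 : π ∣ E.conj π := ⟨u, hu⟩
          exact hβ (h4.trans h3)
        have h3 : π * (β * u ^ 2 * E.conj β) = n' ^ 3 := by
          apply mul_left_cancel₀ hπ.ne_zero
          rw [← h1, map_mul, map_pow, hu]; ring
        obtain ⟨n'', rfl⟩ := hπ.dvd_of_dvd_pow (n := 3) ⟨_, h3.symm⟩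
        have h4 : β * u ^ 2 * E.conj β = π ^ 2 * n'' ^ 3 := by
          apply mul_left_cancel₀ hπ.ne_zero
          rw [h3]; ring
        have hdvd : π ∣ β * u ^ 2 * E.conj β := by
          rw [h4]; exact dvd_mul_of_dvd_left (dvd_pow_self _ two_ne_zero) _
        have hu' : ¬ π ∣ u := by
          rintro ⟨w, rfl⟩
          have h5 : E.conj π ∣ π := E.conj_dvd_iff.2 ⟨_, hu⟩
          rw [hu] at h5
          have h6 : π * π ∣ π * 1 := by
            rw [mul_one]; exact (Dvd.intro w (by ring)).trans h5
          exact hπ.not_isUnit (isUnit_of_dvd_one ((mul_dvd_mul_iff_left hπ.ne_zero).1 h6))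
        rcases hπ.dvd_or_dvd hdvd with h | h
        · rcases hπ.dvd_or_dvd h with h | h
          · exact hβ h
          · exact hu' (hπ.dvd_of_dvd_pow h)
        · exact hcβ h
      · refine hgood π hπ hna (mul_dvd_mul_left _ ?_)
        rw [map_mul, map_pow] at h2
        have := (hπ.dvd_or_dvd h2).resolve_left (fun h => hna (hπ.dvd_of_dvd_pow h))
        exact E.conj_dvd_iff.2 this
    · obtain ⟨β, rfl⟩ := hπα
      have hβ : ¬ π ∣ β := by
        rintro ⟨γ, rfl⟩
        exact hsq ⟨γ, by ring⟩
      -- With `π` dividing `α` exactly once, the cube norm forces `π²` to divide the conjugate of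
      -- `α`. So `π̄²` divides `α`, and the roles of `π` and `π̄` are exchanged.
      have h1 : β * E.conj (π * β) = π ^ 2 * n' ^ 3 := by
        apply mul_left_cancel₀ hπ.ne_zero
        rw [← mul_assoc, hn, hn']; ring
      have h2 : π ^ 2 ∣ E.conj (π * β) :=
        hπ.pow_dvd_of_dvd_mul_left 2 hβ (h1 ▸ dvd_mul_right _ _)
      have h3 : E.conj π ^ 2 ∣ π * β := by
        rw [← map_pow]; exact E.conj_dvd_iff.2 h2
      have hna : ¬ E.conj π ∣ E.conj (E.conj π) := by
        rw [E.conj_conj]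
        intro h
        have h4 : π ∣ E.conj π := E.conj_dvd_iff.1 h
        exact hsq ((pow_dvd_pow_of_dvd h4 2).trans h3)
      refine hgood (E.conj π) hcπ hna ?_
      rw [E.conj_conj, mul_comm]
      refine mul_dvd_mul_left π (hcπ.pow_dvd_of_dvd_mul_left 2 ?_ h3)
      rwa [E.conj_conj] at hna

include E in
/-- The cubic case of the theorem of Kronecker and Weber. -/
theorem exists_fieldRange_le_rootsField [IsPrincipalIdealRing R] {K : Type*} [Field K]
    [NumberField K] [IsGalois ℚ K] (hK : Module.finrank ℚ K = 3) (φ : K →ₐ[ℚ] Ω) :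
    ∃ M : ℕ, IsAdmissible M ∧ φ.fieldRange ≤ rootsField Ω M := by
  obtain ⟨σ, hσ⟩ := exists_ne_one hK
  set w : Ω := ι E.ω with hw
  have hw2 : w ^ 2 + w + 1 = 0 := by
    rw [hw, ← map_pow, ← map_add, ← map_one ι, ← map_add, E.sq_add, map_zero]
  have hw3 : w ^ 3 = 1 := by linear_combination (w - 1) * hw2
  let f : 𝓞 K → Ω := fun x => φ x
  have hfadd : ∀ x y, f (x + y) = f x + f y := fun x y => by simp [f]
  have hfmul : ∀ x y, f (x * y) = f x * f y := fun x y => by simp [f]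
  have hfint : ∀ n : ℤ, f n = n := fun n => by simp [f]
  have hfinj : Function.Injective f := φ.injective.comp RingOfIntegers.coe_injective
  let s := intGal σ
  -- The Lagrange resolvent. If it vanished at both `x` and `x²`, then `(σ x - x)(σ x - σ² x)` would
  -- vanish.
  let r : 𝓞 K → Ω := fun x => f x + w * f (s x) + w ^ 2 * f (s (s x))
  obtain ⟨x, hx⟩ : ∃ x, r x ≠ 0 := by
    by_contra! h0
    obtain ⟨x, hx⟩ := exists_not_dvd_sub hK hσ Nat.prime_two
    have e1 := h0 x
    have e2 := h0 (x * x)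
    have hne1 : f (s x) - f x ≠ 0 := by
      rw [sub_ne_zero]
      intro h
      exact hx (by rw [show intGal σ x = x from hfinj h, sub_self]; exact dvd_zero _)
    have hne2 : f (s x) - f (s (s x)) ≠ 0 := by
      rw [sub_ne_zero]
      intro h
      have := hfinj h
      exact hx (by rw [show intGal σ x = x from (s.injective this).symm, sub_self]; exact dvd_zero _)
    simp only [r, map_mul, hfmul] at e1 e2
    apply mul_ne_zero hne1 hne2
    have hwne : w ≠ 0 := by
      intro h
      rw [h] at hw3
      norm_num at hw3
    apply mul_left_cancel₀ hwne
    rw [mul_zero]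
    linear_combination e2 - (f x + f (s (s x))) * e1 + f x * f (s (s x)) * hw2
  obtain ⟨t, ht⟩ := exists_int_trace hK hσ x
  obtain ⟨A₁, hA₁⟩ := exists_int_trace hK hσ (x ^ 3)
  obtain ⟨B, hB⟩ := exists_int_trace hK hσ (x ^ 2 * s x)
  obtain ⟨C, hC⟩ := exists_int_trace hK hσ (x * s x ^ 2)
  obtain ⟨D, hD⟩ := exists_int_trace hK hσ (x * s x)
  obtain ⟨Q, hQ⟩ := exists_int_trace hK hσ (x ^ 2)
  have hN := intNorm_eq_mul_mul hK hσ x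
  set N := Algebra.norm ℤ x
  have hsss : s (s (s x)) = x := intGal_intGal_intGal hK σ x
  simp only [map_mul, map_pow] at hA₁ hB hC hD hQ
  change x + s x + s (s x) = t at ht
  change x ^ 3 + s x ^ 3 + s (s x) ^ 3 = A₁ at hA₁
  change x ^ 2 * s x + s x ^ 2 * s (s x) + s (s x) ^ 2 * s (s (s x)) = B at hB
  change x * s x ^ 2 + s x * s (s x) ^ 2 + s (s x) * s (s (s x)) ^ 2 = C at hC
  change x * s x + s x * s (s x) + s (s x) * s (s (s x)) = D at hD
  change x ^ 2 + s x ^ 2 + s (s x) ^ 2 = Q at hQ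
  change (N : 𝓞 K) = x * s x * s (s x) at hN
  rw [hsss] at hB hC hD
  have hA₁' := congrArg f hA₁
  have hB' := congrArg f hB
  have hC' := congrArg f hC
  have hD' := congrArg f hD
  have hQ' := congrArg f hQ
  have hN' := congrArg f hN
  have ht' := congrArg f ht
  simp only [pow_succ, pow_zero, one_mul, hfadd, hfmul, hfint] at hA₁' hB' hC' hD' hQ' hN' ht'
  set a := f x
  set b := f (s x)
  set c := f (s (s x))
  let r' : Ω := a + w ^ 2 * b + w * c
  -- The cube of the resolvent: its coefficients are the traces of `x³`, `x² σ x` and `x (σ x)²`,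
  -- with `6 N` from the mixed term `6 x σ(x) σ²(x)`.
  let α : R := ((A₁ + 6 * N : ℤ) : R) + ((3 * B : ℤ) : R) * E.ω + ((3 * C : ℤ) : R) * E.ω ^ 2
  have hr : r x ^ 3 = ι α := by
    simp only [α, map_add, map_mul, map_intCast, map_pow, ← hw, r]
    push_cast
    rw [← hA₁', ← hB', ← hC', hN']
    linear_combination ((w ^ 3 + 1) * c ^ 3 + b ^ 3 + 3 * w * b ^ 2 * c
      + 6 * a * b * c + 3 * w * a * c ^ 2 + 3 * w ^ 2 * b * c ^ 2) * hw3
  have hr' : r' ^ 3 = ι (E.conj α) := by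
    simp only [α, map_add, map_mul, map_intCast, map_pow, ← hw, r', E.conj_ω]
    push_cast
    rw [← hA₁', ← hB', ← hC', hN']
    linear_combination (b ^ 3 * (w ^ 3 + 1) + c ^ 3 - 3 * a ^ 2 * c * w + 3 * b ^ 2 * c * w ^ 2
      + 6 * a * b * c) * hw3
  have hrr : r x * r' = ((Q - D : ℤ) : Ω) := by
    push_cast
    rw [← hQ', ← hD']
    simp only [r, r']
    linear_combination (b ^ 2 + c ^ 2 + b * c * w) * hw3 + (a * b + a * c + b * c) * hw2
  have hα0 : α ≠ 0 := by
    intro h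
    rw [h, map_zero] at hr
    exact hx (pow_eq_zero_iff (by norm_num) |>.1 hr)
  have hnorm : α * E.conj α = ((Q - D : ℤ) : R) ^ 3 := by
    apply hι
    rw [map_mul, ← hr, ← hr', map_pow, map_intCast, ← hrr]; ring
  obtain ⟨k, hk⟩ := E.exists_norm α
  have hpos : 0 ≤ Q - D := by
    rw [hk] at hnorm
    have h3 : (k : ℤ) = (Q - D) ^ 3 := by exact_mod_cast hnorm
    by_contra hneg
    have : (Q - D) ^ 3 < 0 := Odd.pow_neg (by decide) (not_le.1 hneg)
    omega
  obtain ⟨n, hn⟩ := Int.eq_ofNat_of_zero_le hpos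
  rw [hn, Int.cast_natCast] at hnorm
  obtain ⟨M, hM, z, hz, hz3⟩ := hasCyclotomicCubeRoot_of_norm_eq_cube E hι n α hα0 hnorm
  refine ⟨Nat.lcm M 3, hM.lcm (.prime Nat.prime_three), ?_⟩
  set T := rootsField Ω (Nat.lcm M 3) with hT
  have hz0 : z ≠ 0 := by
    rintro rfl
    rw [← hr, zero_pow (by norm_num)] at hz3
    exact hx (pow_eq_zero_iff (by norm_num) |>.1 hz3.symm)
  -- The resolvent and `z` have the same cube, hence differ by a cube root of unity.
  have hrT : r x ∈ T := by
    have : r x = z * (r x / z) := by field_simp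
    rw [this]
    refine mul_mem (rootsField_mono (Nat.dvd_lcm_left M 3) hz)
      (rootsField_mono (Nat.dvd_lcm_right M 3) (mem_rootsField ?_))
    rw [div_pow, hr, hz3, div_self]
    rw [← hz3]; exact pow_ne_zero 3 hz0
  have hr'T : r' ∈ T := by
    have : r' = ((Q - D : ℤ) : Ω) / r x := by rw [← hrr]; field_simp
    rw [this]
    exact div_mem (intCast_mem _ _) hrT
  -- Adding the trace and the two resolvents recovers `3 a`.
  have haT : a ∈ T := by
    have : a = ((t : Ω) + r x + r') / 3 := by
      rw [eq_div_iff (by norm_num), ← ht']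
      simp only [r, r']
      linear_combination -(b + c) * hw2
    rw [this]
    exact div_mem (add_mem (add_mem (intCast_mem _ _) hrT) hr'T) (ofNat_mem _ 3)
  have : Fact (Module.finrank ℚ K).Prime := ⟨hK ▸ Nat.prime_three⟩
  have hsimple : IsSimpleOrder (IntermediateField ℚ K) :=
    IntermediateField.isSimpleOrder_of_finrank_prime ℚ K (hK ▸ Nat.prime_three)
  rcases hsimple.eq_bot_or_eq_top (T.comap φ) with h | h
  · exfalso
    have hxb : (x : K) ∈ T.comap φ := haT
    rw [h, IntermediateField.mem_bot] at hxb
    obtain ⟨q, hq⟩ := hxb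
    have hfix : s x = x := RingOfIntegers.coe_injective (by
      change σ x = x
      rw [← hq, AlgEquiv.commutes])
    apply hx
    simp only [r, hfix]
    linear_combination f x * hw2
  · rintro _ ⟨y, rfl⟩
    have : y ∈ T.comap φ := by rw [h]; trivial
    exact this

end KroneckerWeber

/-! ### The conductor and the norm of the difference ideal -/

section Conductor

variable {K : Type*} [Field K] [NumberField K] [IsGalois ℚ K] (hK : Module.finrank ℚ K = 3)

include hK

theorem exists_isAdmissible_nonempty_algHom :
    ∃ M : ℕ, IsAdmissible M ∧ Nonempty (K →ₐ[ℚ] CyclotomicField M ℚ) := by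
  have : NeZero 3 := ⟨by norm_num⟩
  have := isCyclotomicExtension_cyclotomicField 3
  have : NumberField (CyclotomicField 3 ℚ) := IsCyclotomicExtension.numberField {3} ℚ _
  obtain ⟨E⟩ := exists_eisensteinData (CyclotomicField 3 ℚ)
  have hpid := IsCyclotomicExtension.Rat.three_pid (CyclotomicField 3 ℚ)
  let Ω := AlgebraicClosure K
  have : Algebra.IsAlgebraic ℚ Ω := Algebra.IsAlgebraic.trans ℚ K Ω
  let φ : K →ₐ[ℚ] Ω := (algebraMap K Ω).toRatAlgHom
  let ψ : CyclotomicField 3 ℚ →ₐ[ℚ] Ω := IsAlgClosed.lift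
  obtain ⟨M, hM, hle⟩ := exists_fieldRange_le_rootsField E
    (ι := (ψ : CyclotomicField 3 ℚ →+* Ω).comp (algebraMap (𝓞 (CyclotomicField 3 ℚ)) _))
    (ψ.injective.comp RingOfIntegers.coe_injective) hK φ
  have : NeZero M := ⟨hM.ne_zero⟩
  have := isCyclotomicExtension_cyclotomicField M
  obtain ⟨η, hη⟩ := HasEnoughRootsOfUnity.exists_primitiveRoot Ω M
  exact ⟨M, hM, nonempty_algHom_of_fieldRange_le hη φ (hle.trans (rootsField_le_adjoin hM.ne_zero hη))⟩

/-- Take the least admissible level `M`. Minimality makes all its primes ramified, since the others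
could be removed. Conversely ramified primes, and 9 if 3 ramifies, divide every level containing
`K`; as `M` is admissible it divides every such level, so it is the conductor. -/
theorem conductor_spec : IsAdmissible (conductor K) ∧
    (∀ p : ℕ, p.Prime → (p ∣ conductor K ↔ IsTotallyRamified K p)) ∧
    (IsTotallyRamified K 3 → 9 ∣ conductor K) := by
  classical
  let S : ℕ → Prop := fun M => IsAdmissible M ∧ Nonempty (K →ₐ[ℚ] CyclotomicField M ℚ)
  have hex : ∃ M, S M := exists_isAdmissible_nonempty_algHom hK
  obtain ⟨hM, hφ⟩ := Nat.find_spec hex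
  have hmin := fun m => Nat.find_min hex (m := m)
  set M := Nat.find hex
  have hram : ∀ p : ℕ, p.Prime → p ∣ M → IsTotallyRamified K p := by
    intro p hp hd
    by_contra hno
    obtain ⟨k, m, hpm, hkm⟩ := Nat.exists_eq_pow_mul_and_not_dvd hM.ne_zero p hp.ne_one
    have hk : k ≠ 0 := by rintro rfl; rw [pow_zero, one_mul] at hkm; exact hpm (hkm ▸ hd)
    have hm0 : m ≠ 0 := by rintro rfl; simp at hpm
    have hlt : m < M := by
      rw [hkm]
      exact lt_mul_of_one_lt_left (Nat.pos_of_ne_zero hm0) (Nat.one_lt_pow hk hp.one_lt)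
    refine hmin m hlt ⟨hM.of_dvd ⟨p ^ k, by rw [hkm, mul_comm]⟩, ?_⟩
    rw [hkm] at hφ
    exact nonempty_algHom_cyclotomicField_of_not_ramified hK hp hm0 hno hφ
  have hdvd : ∀ m : ℕ, m ≠ 0 → Nonempty (K →ₐ[ℚ] CyclotomicField m ℚ) → M ∣ m := by
    rintro m hm ⟨φ⟩
    rw [← Nat.factorization_prime_le_iff_dvd hM.ne_zero hm]
    intro p hp
    by_cases hpM : p ∣ M
    · obtain ⟨h1, h2⟩ := dvd_of_isTotallyRamified hp (hram p hp hpM) hm φ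
      by_cases hp3 : p = 3
      · subst hp3
        have h4 : ¬ 3 ≤ M.factorization 3 := by
          rw [← hp.pow_dvd_iff_le_factorization hM.ne_zero]; exact hM.not_dvd
        have h5 : 2 ≤ m.factorization 3 := by
          rw [← hp.pow_dvd_iff_le_factorization hm]; exact h2 rfl
        omega
      · have h4 : ¬ 2 ≤ M.factorization p := by
          rw [← hp.pow_dvd_iff_le_factorization hM.ne_zero]
          exact fun h => hp3 (hM.eq_three p hp h)
        have h5 : 1 ≤ m.factorization p := by
          rw [← hp.pow_dvd_iff_le_factorization hm, pow_one]; exact h1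
        omega
    · rw [Nat.factorization_eq_zero_of_not_dvd hpM]; exact Nat.zero_le _
  have hMS : M ∈ {m : ℕ | 0 < m ∧ Nonempty (K →ₐ[ℚ] CyclotomicField m ℚ)} :=
    ⟨Nat.pos_of_ne_zero hM.ne_zero, hφ⟩
  have hc : conductor K = M := by
    obtain ⟨h1, h2⟩ := Nat.sInf_mem (Set.nonempty_of_mem hMS)
    exact le_antisymm (Nat.sInf_le hMS) (Nat.le_of_dvd h1 (hdvd _ h1.ne' h2))
  obtain ⟨φ⟩ := hφ
  rw [hc]
  exact ⟨hM, fun p hp => ⟨hram p hp, fun h => (dvd_of_isTotallyRamified hp h hM.ne_zero φ).1⟩,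
    fun h => (dvd_of_isTotallyRamified Nat.prime_three h hM.ne_zero φ).2 rfl⟩

theorem conductor_ne_zero : conductor K ≠ 0 := (conductor_spec hK).1.ne_zero

theorem not_cube_dvd_conductor {p : ℕ} (hp : p.Prime) : ¬ p ^ 3 ∣ conductor K := by
  intro h
  have hadm := (conductor_spec hK).1
  obtain rfl := hadm.eq_three p hp ((pow_dvd_pow p (by norm_num)).trans h)
  exact hadm.not_dvd h

theorem absNorm_differenceIdeal {σ : K ≃ₐ[ℚ] K} (hσ : σ ≠ 1) :
    Ideal.absNorm (differenceIdeal σ) = conductor K := by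
  obtain ⟨hadm, hiff, h9⟩ := conductor_spec hK
  refine Nat.eq_of_factorization_eq ?_ hadm.ne_zero fun p => ?_
  · rw [Ne, Ideal.absNorm_eq_zero_iff]; exact differenceIdeal_ne_bot hK hσ
  by_cases hp : p.Prime
  swap
  · rw [Nat.factorization_eq_zero_of_not_prime _ hp, Nat.factorization_eq_zero_of_not_prime _ hp]
  by_cases hr : IsTotallyRamified K p
  · by_cases hp3 : p = 3
    · subst hp3
      rw [factorization_absNorm_differenceIdeal_three hK hr hσ]
      have h4 : ¬ 3 ≤ (conductor K).factorization 3 := by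
        rw [← hp.pow_dvd_iff_le_factorization hadm.ne_zero]; exact hadm.not_dvd
      have h5 : 2 ≤ (conductor K).factorization 3 := by
        rw [← hp.pow_dvd_iff_le_factorization hadm.ne_zero]; exact h9 hr
      omega
    · rw [factorization_absNorm_differenceIdeal_of_ne_three hK hp hp3 hr hσ]
      have h4 : ¬ 2 ≤ (conductor K).factorization p := by
        rw [← hp.pow_dvd_iff_le_factorization hadm.ne_zero]
        exact fun h => hp3 (hadm.eq_three p hp h)
      have h5 : 1 ≤ (conductor K).factorization p := by
        rw [← hp.pow_dvd_iff_le_factorization hadm.ne_zero, pow_one]; exact (hiff p hp).2 hr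
      omega
  · rw [factorization_absNorm_differenceIdeal_of_not hK hp hr hσ,
      Nat.factorization_eq_zero_of_not_dvd (fun h => hr ((hiff p hp).1 h))]

theorem ideal_eq_of_absNorm_eq_conductor {I J : Ideal (𝓞 K)}
    (hI : Ideal.absNorm I = conductor K) (hJ : Ideal.absNorm J = conductor K) : I = J :=
  ideal_eq_of_absNorm_eq hK _ (conductor_ne_zero hK)
    (fun p hp h => ((conductor_spec hK).2.1 p hp).1 h) I J hI hJ

end Conductor

/-! ### Power bases and generators of the ideal of norm `c_K` -/

section Monogenic

variable {K : Type*} [Field K] [NumberField K] [IsGalois ℚ K] (hK : Module.finrank ℚ K = 3)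
variable {C : Ideal (𝓞 K)}

/-- The map `σ - 1` is a twisted derivation, so its values on `ℤ[γ]` are multiples of its value at
`γ`. -/
theorem differenceIdeal_eq_span_of_adjoin_eq_top {K : Type*} [Field K] [NumberField K]
    (σ : K ≃ₐ[ℚ] K) {γ : 𝓞 K} (hγ : Algebra.adjoin ℤ {γ} = ⊤) :
    differenceIdeal σ = Ideal.span {intGal σ γ - γ} := by
  apply le_antisymm
  · rw [differenceIdeal_le_iff]
    intro x
    have hx : x ∈ Algebra.adjoin ℤ {γ} := by rw [hγ]; trivial
    induction hx using Algebra.adjoin_induction with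
    | mem x hx =>
      rw [Set.mem_singleton_iff.1 hx]; exact Ideal.mem_span_singleton_self _
    | algebraMap n => simp
    | add x y _ _ hx hy =>
      have : intGal σ (x + y) - (x + y) = (intGal σ x - x) + (intGal σ y - y) := by
        rw [map_add]; ring
      rw [this]; exact Ideal.add_mem _ hx hy
    | mul x y _ _ hx hy =>
      have : intGal σ (x * y) - x * y =
          intGal σ x * (intGal σ y - y) + y * (intGal σ x - x) := by
        rw [map_mul]; ring
      rw [this]
      exact Ideal.add_mem _ (Ideal.mul_mem_left _ _ hy) (Ideal.mul_mem_left _ _ hx)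
  · rw [Ideal.span_singleton_le_iff_mem]
    exact Ideal.subset_span ⟨γ, rfl⟩

include hK

/-- A conjugate of `β` generates an ideal of the same norm `c_K`, and there is only one. -/
theorem exists_unit_gal_eq {β : 𝓞 K} (hC : Ideal.absNorm C = conductor K)
    (hβ : C = Ideal.span {β}) (τ : K ≃ₐ[ℚ] K) :
    ∃ u : (𝓞 K)ˣ, intGal τ β = u * β := by
  have h : Ideal.absNorm (Ideal.span {intGal τ β}) = conductor K := by
    rw [← hC, hβ, Ideal.absNorm_span_singleton, Ideal.absNorm_span_singleton]
    congr 1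
    have h1 : (Algebra.norm ℚ (τ β) : ℚ) = Algebra.norm ℚ (β : K) := Algebra.norm_eq_of_algEquiv τ _
    rw [← coe_intGal, ← Algebra.coe_norm_int, ← Algebra.coe_norm_int] at h1
    exact_mod_cast h1
  have heq := ideal_eq_of_absNorm_eq_conductor hK h hC
  rw [hβ, Ideal.span_singleton_eq_span_singleton] at heq
  obtain ⟨u, hu⟩ := heq.symm
  exact ⟨u, by rw [← hu, mul_comm]⟩

theorem ne_zero_of_span_eq {β : 𝓞 K} (hC : Ideal.absNorm C = conductor K)
    (hβ : C = Ideal.span {β}) : β ≠ 0 := by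
  rintro rfl
  rw [hβ] at hC
  have := conductor_ne_zero hK
  simp at hC
  exact this hC.symm

/-- `γ` generates `𝓞 K` as soon as `γ - σ γ` generates the ideal of norm the conductor. -/
theorem isMonogenic_of_span_sub_eq (hC : Ideal.absNorm C = conductor K) {σ : K ≃ₐ[ℚ] K}
    (hσ : σ ≠ 1) {g : 𝓞 K} (hg : C = Ideal.span {g - intGal σ g}) : IsMonogenic K := by
  refine ⟨g, ?_⟩
  rw [eq_top_iff]
  rintro x -
  have hCd := ideal_eq_of_absNorm_eq_conductor hK hC (absNorm_differenceIdeal hK hσ)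
  set s := intGal σ with hs
  have hsss : ∀ y, s (s (s y)) = y := intGal_intGal_intGal hK σ
  have hdvd : ∀ y, ∃ w, y - s y = (g - s g) * w := by
    intro y
    have : s y - y ∈ C := by rw [hCd]; exact differenceIdeal_le_iff.1 le_rfl y
    rw [hg, Ideal.mem_span_singleton] at this
    obtain ⟨w, hw⟩ := this
    exact ⟨-w, by linear_combination -hw⟩
  have hg0 := ne_zero_of_span_eq hK hC hg
  have hsg0 : s g - s (s g) ≠ 0 := by
    intro h; apply hg0; apply s.injective; rw [map_sub, h, map_zero]
  have hssg0 : s (s g) - g ≠ 0 := by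
    intro h; apply hsg0; apply s.injective; rw [map_sub, hsss, h, map_zero]
  obtain ⟨v, hv⟩ := exists_unit_gal_eq hK hC hg (σ ^ 2)
  have hv' : s (s g) - g = v * (g - s g) := by
    rw [← hv, pow_two, intGal_mul_apply]
    change _ = s (s (g - s g))
    rw [map_sub, map_sub, hsss]
  have hint : ∀ y, s y = y → ∃ n : ℤ, y = n := fun y hy => exists_int_of_fixed hK hσ hy
  -- Newton interpolation of `x` at the conjugates of `g`: `w` and `z` are the first and second
  -- divided differences. They are integral because all differences of conjugates of `g` are
  -- associated. The second one is symmetric, hence a rational integer; subtracting its contribution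
  -- leaves `w`, then `x`, to be treated likewise.
  obtain ⟨w, hw⟩ := hdvd x
  obtain ⟨z', hz'⟩ := hdvd w
  obtain ⟨z, hz⟩ : ∃ z, w - s w = (g - s (s g)) * z := by
    refine ⟨-(((v⁻¹ : (𝓞 K)ˣ) : 𝓞 K)) * z', ?_⟩
    have h1 : (v : 𝓞 K) * ((v⁻¹ : (𝓞 K)ˣ) : 𝓞 K) = 1 := v.mul_inv
    linear_combination hz' - (((v⁻¹ : (𝓞 K)ˣ) : 𝓞 K)) * z' * hv' - (g - s g) * z' * h1
  have hsw : s x - s (s x) = (s g - s (s g)) * s w := by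
    have := congrArg s hw
    simpa using this
  have hV : ∀ y, (s (s g) - g) * (g - s g) * (s g - s (s g)) * y = 0 → y = 0 := by
    intro y hy
    exact (mul_eq_zero.1 hy).resolve_left (mul_ne_zero (mul_ne_zero hssg0 hg0) hsg0)
  have hR : (g - s (s g)) * (g - s g) * (s g - s (s g)) * z =
      (x - s x) * (s g - s (s g)) - (s x - s (s x)) * (g - s g) := by
    rw [hw, hsw]
    linear_combination (-(g - s g) * (s g - s (s g))) * hz
  have hsR := congrArg s hR
  simp only [map_mul, map_sub, hsss] at hsR
  have hsz : s z = z := by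
    rw [← sub_eq_zero]
    apply hV
    linear_combination hR - hsR
  obtain ⟨n₂, rfl⟩ := hint z hsz
  obtain ⟨n₁, hn₁⟩ := hint (w - n₂ * (g + s g)) (by
    simp only [map_sub, map_mul, map_add, map_intCast]
    linear_combination -hz)
  obtain ⟨n₀, hn₀⟩ := hint (x - n₂ * g ^ 2 - n₁ * g) (by
    simp only [map_sub, map_mul, map_pow, map_intCast]
    linear_combination -hw - (g - s g) * hn₁)
  have hx : x = n₀ + n₁ * g + n₂ * g ^ 2 := by linear_combination hn₀
  have hmem : g ∈ Algebra.adjoin ℤ {g} := Algebra.self_mem_adjoin_singleton ℤ g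
  rw [hx]
  exact add_mem (add_mem (intCast_mem _ _) (mul_mem (intCast_mem _ _) hmem))
    (mul_mem (intCast_mem _ _) (pow_mem hmem 2))

/-- Some trace is prime to `3` when `3` is not ramified. -/
theorem exists_trace_not_dvd (h3 : ¬ IsTotallyRamified K 3) {σ : K ≃ₐ[ℚ] K} (hσ : σ ≠ 1) :
    ∃ (x : 𝓞 K) (T : ℤ), x + intGal σ x + intGal σ (intGal σ x) = T ∧ ¬ 3 ∣ T := by
  by_contra! hall
  apply h3
  obtain ⟨Q, hQ, hlo⟩ := exists_isMaximal_liesOver K Nat.prime_three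
  have hQp := hQ.isPrime
  have h3Q : (3 : 𝓞 K) ∈ Q := by simpa using natCast_mem_of_liesOver (p := 3) Q
  -- If 3 divides all traces, the characteristic polynomial of `x` is `X³ - N` modulo 3, and `N ≡
  -- N³`, so `(x - N)³` lies in `Q`. Conjugates share `N`, hence `σ` is trivial modulo `Q`. The
  -- factor 2 below avoids dividing in `(t² - q) / 2`.
  have key : ∀ x : 𝓞 K, x - (Algebra.norm ℤ x : ℤ) ∈ Q := by
    intro x
    obtain ⟨t, ht⟩ := exists_int_trace hK hσ x
    obtain ⟨q, hq⟩ := exists_int_trace hK hσ (x ^ 2)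
    obtain ⟨t', rfl⟩ := hall x t ht
    obtain ⟨q', rfl⟩ := hall _ q hq
    have hN := intNorm_eq_mul_mul hK hσ x
    set N := Algebra.norm ℤ x
    simp only [map_pow] at hq
    push_cast at ht hq
    obtain ⟨k, hk⟩ : (3 : ℤ) ∣ N ^ 3 - N := by
      have : N % 3 = 0 ∨ N % 3 = 1 ∨ N % 3 = 2 := by omega
      have h2 : N ^ 3 - N = (N - 1) * N * (N + 1) := by ring
      rw [h2]
      rcases this with h | h | h
      · exact Dvd.dvd.mul_right (Dvd.dvd.mul_left (by omega) _) _
      · exact Dvd.dvd.mul_right (Dvd.dvd.mul_right (by omega) _) _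
      · exact Dvd.dvd.mul_left (by omega) _
    have hk' : (N : 𝓞 K) ^ 3 - N = 3 * k := by exact_mod_cast congrArg (Int.cast (R := 𝓞 K)) hk
    have hdouble : (2 : 𝓞 K) * (x - N) ^ 3 ∈ Q := by
      have : (2 : 𝓞 K) * (x - N) ^ 3 = 3 * (2 * t' * x ^ 2 - (3 * t' ^ 2 - q') * x
          - 2 * x ^ 2 * N + 2 * x * N ^ 2 - 2 * k) := by
        linear_combination (2 * x ^ 2 - x * (x + intGal σ x + intGal σ (intGal σ x) + 3 * t')) * ht
          + x * hq - 2 * hN - 2 * hk'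
      rw [this]
      exact Q.mul_mem_right _ h3Q
    have h2 : (x - N) ^ 3 ∈ Q := by
      have : (x - (N : 𝓞 K)) ^ 3 = 3 * (x - N) ^ 3 - 2 * (x - N) ^ 3 := by ring
      rw [this]
      exact Q.sub_mem (Q.mul_mem_right _ h3Q) hdouble
    exact hQp.mem_of_pow_mem 3 h2
  refine isTotallyRamified_of_forall_intGal_sub_mem hK Nat.prime_three hσ hQp (by simpa using h3Q) ?_
  intro x
  have h1 := key x
  have h2 := key (intGal σ x)
  have hN : Algebra.norm ℤ (intGal σ x) = Algebra.norm ℤ x := by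
    have : ((Algebra.norm ℤ (intGal σ x) : ℤ) : 𝓞 K) = (Algebra.norm ℤ x : ℤ) := by
      rw [intNorm_eq_mul_mul hK hσ, intNorm_eq_mul_mul hK hσ, intGal_intGal_intGal hK]; ring
    exact_mod_cast this
  rw [hN] at h2
  have : intGal σ x - x = (intGal σ x - (Algebra.norm ℤ x : ℤ)) - (x - (Algebra.norm ℤ x : ℤ)) := by
    ring
  rw [this]
  exact Q.sub_mem h2 h1

end Monogenic

/-! ### Shanks polynomials and the action of the Galois group on their roots -/

section Shanks

variable {K : Type*} [Field K]

theorem shanksDelta_pos (t : ℤ) : 0 < shanksDelta t := by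
  unfold shanksDelta
  nlinarith [sq_nonneg (2 * t + 3)]

theorem IsShanksRoot.ne_zero {t : ℤ} {θ : K} (h : IsShanksRoot t θ) : θ ≠ 0 := by
  rintro rfl
  simp [IsShanksRoot] at h

theorem IsShanksRoot.one_add_ne_zero {t : ℤ} {θ : K} (h : IsShanksRoot t θ) : 1 + θ ≠ 0 := by
  intro h0
  have hθ : θ = -1 := by linear_combination h0
  rw [IsShanksRoot, hθ] at h
  have : (1 : K) = 0 := by linear_combination h
  exact one_ne_zero this

theorem IsShanksRoot.gal [CharZero K] {t : ℤ} {θ : K} (h : IsShanksRoot t θ) (σ : K ≃ₐ[ℚ] K) :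
    IsShanksRoot t (σ θ) := by
  have := congrArg σ h
  simpa [IsShanksRoot, map_ofNat] using this

theorem isShanksRoot_of_trace {t : ℤ} {e : K} (he : e ≠ 0) (he1 : 1 + e ≠ 0)
    (ht : e + -((1 + e) / e) + -(1 / (1 + e)) = t) : IsShanksRoot t e := by
  rw [IsShanksRoot, ← ht]
  field_simp
  ring

theorem isIntegral_of_isShanksRoot {t : ℤ} {θ : K} (h : IsShanksRoot t θ) : IsIntegral ℤ θ := by
  refine ⟨Polynomial.X ^ 3 - (Polynomial.C t) * Polynomial.X ^ 2 - (Polynomial.C (t + 3)) * Polynomial.X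
    - Polynomial.C 1, ?_, ?_⟩
  · monicity!
  · rw [IsShanksRoot] at h
    simpa [-eq_intCast, Polynomial.eval₂_C] using h

theorem exists_unit_of_isIntegral {x : K} (hx : x ≠ 0) (h1 : IsIntegral ℤ x)
    (h2 : IsIntegral ℤ x⁻¹) : ∃ u : (𝓞 K)ˣ, ((u : 𝓞 K) : K) = x := by
  refine ⟨⟨⟨x, h1⟩, ⟨x⁻¹, h2⟩, ?_, ?_⟩, rfl⟩
  · apply RingOfIntegers.coe_injective
    exact mul_inv_cancel₀ hx
  · apply RingOfIntegers.coe_injective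
    exact inv_mul_cancel₀ hx

theorem IsShanksRoot.exists_unit {t : ℤ} {θ : K} (h : IsShanksRoot t θ) :
    ∃ u : (𝓞 K)ˣ, ((u : 𝓞 K) : K) = θ := by
  have hi := isIntegral_of_isShanksRoot h
  refine exists_unit_of_isIntegral h.ne_zero hi ?_
  have : θ⁻¹ = θ ^ 2 - (t : ℤ) • θ - ((t + 3 : ℤ) : K) := by
    rw [IsShanksRoot] at h
    refine inv_eq_of_mul_eq_one_right ?_
    rw [zsmul_eq_mul]
    push_cast
    linear_combination h
  rw [this]
  exact ((hi.pow 2).sub (hi.smul _)).sub (isIntegral_intCast _)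

variable [NumberField K]

theorem IsSimplestWith.not_rat {t : ℤ} {θ : K} (hK : Module.finrank ℚ K = 3)
    (h : IsSimplestWith t θ) (q : ℚ) : θ ≠ q := by
  rintro rfl
  have hbot : ℚ⟮(q : K)⟯ = ⊥ := by
    rw [IntermediateField.adjoin_simple_eq_bot_iff]
    exact IntermediateField.mem_bot.2 ⟨q, by simp⟩
  have htop := h.2.2
  rw [hbot] at htop
  have h1 := IntermediateField.finrank_top' (F := ℚ) (E := K)
  rw [← htop, IntermediateField.finrank_bot, hK] at h1
  omega

variable [IsGalois ℚ K] (hK : Module.finrank ℚ K = 3)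

include hK

omit [IsGalois ℚ K] in
theorem adjoin_eq_top_of_not_fixed {σ : K ≃ₐ[ℚ] K} {θ : K} (h : σ θ ≠ θ) : ℚ⟮θ⟯ = ⊤ := by
  have hsimple : IsSimpleOrder (IntermediateField ℚ K) :=
    IntermediateField.isSimpleOrder_of_finrank_prime ℚ K (hK ▸ Nat.prime_three)
  refine (hsimple.eq_bot_or_eq_top ℚ⟮θ⟯).resolve_left fun hbot => ?_
  rw [IntermediateField.adjoin_simple_eq_bot_iff, IntermediateField.mem_bot] at hbot
  obtain ⟨q, hq⟩ := hbot
  apply h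
  rw [← hq, AlgEquiv.commutes]

theorem IsSimplestWith.gal_ne {t : ℤ} {θ : K} (h : IsSimplestWith t θ) {σ : K ≃ₐ[ℚ] K}
    (hσ : σ ≠ 1) : σ θ ≠ θ := by
  intro heq
  obtain ⟨q, hq⟩ := exists_rat_of_fixed hK hσ heq
  exact h.not_rat hK q hq

theorem IsSimplestWith.vieta {t : ℤ} {θ : K} (h : IsSimplestWith t θ) {σ : K ≃ₐ[ℚ] K}
    (hσ : σ ≠ 1) : θ + σ θ + σ (σ θ) = t ∧
      θ * σ θ + θ * σ (σ θ) + σ θ * σ (σ θ) = -((t : K) + 3) ∧ θ * σ θ * σ (σ θ) = 1 := by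
  have ha := h.2.1
  have hb := ha.gal σ
  have hc := hb.gal σ
  have hab := h.gal_ne hK hσ
  have hac : σ (σ θ) ≠ θ := by simpa [pow_two] using h.gal_ne hK (sq_ne_one hK hσ)
  have hbc : σ (σ θ) ≠ σ θ := fun heq => hab (σ.injective heq)
  rw [IsShanksRoot] at ha hb hc
  generalize σ (σ θ) = c at *
  generalize σ θ = b at *
  generalize (t : K) = T at *
  have e1 : b ^ 2 + b * θ + θ ^ 2 - T * (b + θ) - (T + 3) = 0 := by
    apply mul_left_cancel₀ (sub_ne_zero.2 hab)
    linear_combination hb - ha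
  have e2 : c ^ 2 + c * θ + θ ^ 2 - T * (c + θ) - (T + 3) = 0 := by
    apply mul_left_cancel₀ (sub_ne_zero.2 hac)
    linear_combination hc - ha
  have e3 : θ + b + c - T = 0 := by
    apply mul_left_cancel₀ (sub_ne_zero.2 hbc)
    linear_combination e2 - e1
  refine ⟨by linear_combination e3, by linear_combination -e1 + (b + θ) * e3, ?_⟩
  linear_combination ha + θ * b * e3 - θ * e1

theorem IsSimplestWith.eq_of_isShanksRoot {t : ℤ} {θ y : K} (h : IsSimplestWith t θ)
    (hy : IsShanksRoot t y) {σ : K ≃ₐ[ℚ] K} (hσ : σ ≠ 1) : y = θ ∨ y = σ θ ∨ y = σ (σ θ) := by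
  obtain ⟨e1, e2, e3⟩ := h.vieta hK hσ
  rw [IsShanksRoot] at hy
  have : (y - θ) * ((y - σ θ) * (y - σ (σ θ))) = 0 := by
    linear_combination hy - y ^ 2 * e1 + y * e2 - e3
  rcases mul_eq_zero.1 this with h | h
  · exact Or.inl (sub_eq_zero.1 h)
  rcases mul_eq_zero.1 h with h | h
  · exact Or.inr (Or.inl (sub_eq_zero.1 h))
  · exact Or.inr (Or.inr (sub_eq_zero.1 h))

/-- The map `x ↦ -(1 + x)/x` sends `θ` to another root: a fixed point would satisfy `θ² + θ + 1 =
0`, and the Shanks equation would then give `3 θ = t`. So it acts on `θ` as `σ` or `σ²`. -/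
theorem IsSimplestWith.exists_datum {t : ℤ} {θ : K} (h : IsSimplestWith t θ) :
    ∃ σ : K ≃ₐ[ℚ] K, IsShanksDatum t θ σ := by
  obtain ⟨σ, hσ⟩ := exists_ne_one hK
  have h0 := h.2.1.ne_zero
  have h1 := h.2.1.one_add_ne_zero
  have hroot : IsShanksRoot t (-((1 + θ) / θ)) := by
    have hθ := h.2.1
    rw [IsShanksRoot] at hθ ⊢
    field_simp
    linear_combination hθ
  have hne : -((1 + θ) / θ) ≠ θ := by
    intro heq
    have hq : θ ^ 2 + θ + 1 = 0 := by
      field_simp at heq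
      linear_combination -heq
    have hθ := h.2.1
    rw [IsShanksRoot] at hθ
    have h3 : 3 * θ = t := by linear_combination (θ - 1 - t) * hq - hθ
    apply h.not_rat hK ((t : ℚ) / 3)
    push_cast
    rw [eq_div_iff (by norm_num)]
    linear_combination h3
  rcases h.eq_of_isShanksRoot hK hroot hσ with he | he | he
  · exact (hne he).elim
  · exact ⟨σ, h, isGaloisGenerator_of_ne_one hK hσ, he.symm⟩
  · exact ⟨σ ^ 2, h, isGaloisGenerator_of_ne_one hK (sq_ne_one hK hσ), by
      rw [he, pow_two, AlgEquiv.mul_apply]⟩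

theorem IsShanksDatum.gal_gal {t : ℤ} {θ : K} {σ : K ≃ₐ[ℚ] K} (h : IsShanksDatum t θ σ) :
    σ (σ θ) = -(1 / (1 + θ)) := by
  obtain ⟨-, -, e3⟩ := h.1.vieta hK (ne_one_of_isGaloisGenerator hK h.2.1)
  have h0 := h.1.2.1.ne_zero
  have h1 := h.1.2.1.one_add_ne_zero
  rw [h.2.2] at e3 ⊢
  field_simp at e3 ⊢
  linear_combination -e3

/-- `σ` multiplies `θ - σ θ` by the conjugate `σ² θ`. -/
theorem IsShanksDatum.gal_sub {t : ℤ} {θ : K} {σ : K ≃ₐ[ℚ] K} (h : IsShanksDatum t θ σ) :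
    σ (θ - σ θ) = σ (σ θ) * (θ - σ θ) := by
  have h0 := h.1.2.1.ne_zero
  have h1 := h.1.2.1.one_add_ne_zero
  rw [map_sub, h.gal_gal hK, h.2.2]
  field_simp
  ring

/-- This product of differences of roots is a square root of the discriminant `Δ_t²`; writing
everything as rational functions of `θ` fixes the sign. -/
theorem IsShanksDatum.norm_sub {t : ℤ} {θ : K} {σ : K ≃ₐ[ℚ] K} (h : IsShanksDatum t θ σ) :
    (θ - σ θ) * σ (θ - σ θ) * σ (σ (θ - σ θ)) = shanksDelta t := by
  obtain ⟨e1, e2, e3⟩ := h.1.vieta hK (ne_one_of_isGaloisGenerator hK h.2.1)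
  have h0 := h.1.2.1.ne_zero
  have h1 := h.1.2.1.one_add_ne_zero
  have hθ := h.1.2.1
  rw [h.gal_sub hK, map_mul, h.gal_sub hK, gal_gal_gal hK, h.gal_gal hK, h.2.2]
  unfold shanksDelta
  push_cast
  rw [← e1, h.gal_gal hK, h.2.2]
  field_simp
  ring

end Shanks

/-! ### Equality of classes in `H¹` and in `P_K^G / P_ℚ`, made explicit -/

section Cohomology

variable {K : Type*} [Field K] [NumberField K]

theorem H1.mk_eq_mk_iff (σ : K ≃ₐ[ℚ] K) (u v : normOneUnits K) :
    H1.mk σ u = H1.mk σ v ↔ ∃ w : (𝓞 K)ˣ,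
      normOneUnits.val v = normOneUnits.val u * (σ ((w : 𝓞 K) : K) / ((w : 𝓞 K) : K)) := by
  rw [H1.mk, H1.mk, QuotientGroup.eq, Subgroup.mem_subgroupOf, MonoidHom.mem_range]
  refine exists_congr fun w => ?_
  rw [← unitSigmaSubOne_apply]
  constructor
  · intro h
    have h2 : (v : (𝓞 K)ˣ) = u * unitSigmaSubOne σ w := by rw [h]; simp
    simp [normOneUnits.val, h2]
  · intro h
    have h2 : (v : (𝓞 K)ˣ) = u * unitSigmaSubOne σ w := by
      apply Units.ext
      apply RingOfIntegers.coe_injective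
      rw [Units.val_mul]
      simpa [normOneUnits.val] using h
    simp [h2]

theorem AmbiguousQuotient.mk_eq_mk_iff {A B : principalAmbiguousIdeals K} {x y : K}
    (hA : principalAmbiguousIdeals.val A = FractionalIdeal.spanSingleton (𝓞 K)⁰ x)
    (hB : principalAmbiguousIdeals.val B = FractionalIdeal.spanSingleton (𝓞 K)⁰ y) :
    AmbiguousQuotient.mk A = AmbiguousQuotient.mk B ↔
      ∃ (q : ℚ) (u : (𝓞 K)ˣ), q ≠ 0 ∧ y = ((u : 𝓞 K) : K) * (q * x) := by
  rw [AmbiguousQuotient.mk, AmbiguousQuotient.mk, QuotientGroup.eq, Subgroup.mem_subgroupOf,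
    rationalPrincipalIdeals, MonoidHom.mem_range]
  have key : ∀ q : ℚˣ, (((toPrincipalIdeal (𝓞 K) K).comp (Units.map (algebraMap ℚ K : ℚ →* K))) q =
      ((A⁻¹ * B : principalAmbiguousIdeals K) : (FractionalIdeal (𝓞 K)⁰ K)ˣ)) ↔
      ∃ u : (𝓞 K)ˣ, y = ((u : 𝓞 K) : K) * ((q : ℚ) * x) := by
    intro q
    have h1 : ((B : (FractionalIdeal (𝓞 K)⁰ K)ˣ) : FractionalIdeal (𝓞 K)⁰ K) =
      FractionalIdeal.spanSingleton (𝓞 K)⁰ y := hB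
    have h2 : ((A : (FractionalIdeal (𝓞 K)⁰ K)ˣ) : FractionalIdeal (𝓞 K)⁰ K) =
      FractionalIdeal.spanSingleton (𝓞 K)⁰ x := hA
    rw [Subgroup.coe_mul, Subgroup.coe_inv, eq_inv_mul_iff_mul_eq, ← Units.val_inj, Units.val_mul,
      h1, h2, MonoidHom.comp_apply, coe_toPrincipalIdeal,
      FractionalIdeal.spanSingleton_mul_spanSingleton,
      FractionalIdeal.spanSingleton_eq_spanSingleton]
    refine exists_congr fun u => ?_
    rw [Units.smul_def, Algebra.smul_def, eq_comm]
    simp [mul_comm]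
  constructor
  · rintro ⟨q, hq⟩
    obtain ⟨u, hu⟩ := (key q).1 hq
    exact ⟨q, u, q.ne_zero, hu⟩
  · rintro ⟨q, u, hq, hu⟩
    exact ⟨Units.mk0 q hq, (key _).2 ⟨u, hu⟩⟩

variable [IsGalois ℚ K] (hK : Module.finrank ℚ K = 3)

include hK

theorem exists_normOneUnits_val_eq {σ : K ≃ₐ[ℚ] K} (hσ : σ ≠ 1) (u : (𝓞 K)ˣ) {x : K}
    (hu : ((u : 𝓞 K) : K) = x) (hx : x * σ x * σ (σ x) = 1) :
    ∃ v : normOneUnits K, normOneUnits.val v = x := by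
  refine ⟨⟨u, ?_⟩, hu⟩
  rw [normOneUnits, MonoidHom.mem_ker]
  change Algebra.norm ℚ ((u : 𝓞 K) : K) = 1
  have h := norm_eq_mul_mul hK hσ x
  rw [hx] at h
  rw [hu]
  exact_mod_cast h

theorem exists_principalAmbiguousIdeals_val_eq {σ : K ≃ₐ[ℚ] K} (hσ : σ ≠ 1) {x : K} (hx : x ≠ 0)
    {u : (𝓞 K)ˣ} (hu : σ x = ((u : 𝓞 K) : K) * x) : ∃ A : principalAmbiguousIdeals K,
      principalAmbiguousIdeals.val A = FractionalIdeal.spanSingleton (𝓞 K)⁰ x := by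
  refine ⟨⟨toPrincipalIdeal (𝓞 K) K (Units.mk0 x hx), ?_, ⟨_, rfl⟩⟩, ?_⟩
  · change IsAmbiguous _
    rw [isAmbiguous_iff, coe_toPrincipalIdeal, Units.val_mk0]
    have h1 : ∀ y ∈ FractionalIdeal.spanSingleton (𝓞 K)⁰ x,
        σ y ∈ FractionalIdeal.spanSingleton (𝓞 K)⁰ x := by
      intro y hy
      rw [FractionalIdeal.mem_spanSingleton] at hy ⊢
      obtain ⟨z, rfl⟩ := hy
      refine ⟨intGal σ z * u, ?_⟩
      simp only [Algebra.smul_def, map_mul, hu]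
      exact mul_assoc _ _ _
    intro τ y hy
    rcases gal_eq_one_or hK hσ τ with rfl | rfl | rfl
    · exact hy
    · exact h1 y hy
    · rw [pow_two, AlgEquiv.mul_apply]; exact h1 _ (h1 y hy)
  · change ((toPrincipalIdeal (𝓞 K) K (Units.mk0 x hx) : (FractionalIdeal (𝓞 K)⁰ K)ˣ) :
      FractionalIdeal (𝓞 K)⁰ K) = _
    rw [coe_toPrincipalIdeal, Units.val_mk0]

end Cohomology

/-! ### From a power basis to a Shanks root -/

section Criterion

variable {K : Type*} [Field K] [NumberField K] [IsGalois ℚ K] (hK : Module.finrank ℚ K = 3)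
variable {C : Ideal (𝓞 K)}

include hK

/-- In a monogenic cyclic cubic field the ideal of norm the conductor has a generator `b` such
that `σ b / b` is a root of a Shanks polynomial. -/
theorem exists_datum_of_isMonogenic (hC : Ideal.absNorm C = conductor K) (h : IsMonogenic K) :
    ∃ (σ : K ≃ₐ[ℚ] K) (b : 𝓞 K) (t : ℤ), C = Ideal.span {b} ∧
      IsShanksDatum t (σ (b : K) / b) σ := by
  obtain ⟨γ, hγ⟩ := h
  have key : ∀ σ : K ≃ₐ[ℚ] K, σ ≠ 1 → ∃ (b : 𝓞 K) (t : ℤ), C = Ideal.span {b} ∧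
      (b : K) = σ γ - γ ∧ b ≠ 0 ∧ IsShanksRoot t (σ (b : K) / b) ∧
      σ (σ (b : K) / b) = -((1 + σ (b : K) / b) / (σ (b : K) / b)) ∧
      (σ (b : K) / b) + σ (σ (b : K) / b) + σ (σ (σ (b : K) / b)) = t ∧
      σ (σ (b : K) / b) ≠ σ (b : K) / b := by
    intro σ hσ
    have hspan : C = Ideal.span {intGal σ γ - γ} := by
      rw [← differenceIdeal_eq_span_of_adjoin_eq_top σ hγ]
      exact ideal_eq_of_absNorm_eq_conductor hK hC (absNorm_differenceIdeal hK hσ)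
    have hb0 := ne_zero_of_span_eq hK hC hspan
    obtain ⟨u, hu⟩ := exists_unit_gal_eq hK hC hspan σ
    set b := intGal σ γ - γ with hb
    have hbK : (b : K) ≠ 0 := by simpa using hb0
    have hb1 : σ (b : K) ≠ 0 := by simpa using hb0
    have hb2 : σ (σ (b : K)) ≠ 0 := by simpa using hb0
    have hbγ : (b : K) = σ γ - γ := by rw [hb]; simp
    -- The trace of `σ γ - γ` vanishes; divided by `b`, this is the relation `1 + e + e σ(e) = 0`
    -- for `e = σ b / b`.
    have hsum : (b : K) + σ b + σ (σ b) = 0 := by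
      rw [hbγ]; simp only [map_sub, gal_gal_gal hK]; ring
    have hue : ((u : 𝓞 K) : K) = σ (b : K) / b := by
      rw [eq_div_iff hbK]
      have := congrArg (fun y : 𝓞 K => (y : K)) hu
      simpa using this.symm
    obtain ⟨t, ht⟩ := exists_int_trace hK hσ (u : 𝓞 K)
    have ht' : (σ (b : K) / b) + σ (σ (b : K) / b) + σ (σ (σ (b : K) / b)) = t := by
      rw [← hue]
      have := congrArg (fun y : 𝓞 K => (y : K)) ht
      simpa using this
    have hse : σ (σ (b : K) / b) = -((1 + σ (b : K) / b) / (σ (b : K) / b)) := by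
      rw [map_div₀]; field_simp; linear_combination hsum
    have hsse : σ (σ (σ (b : K) / b)) = -(1 / (1 + σ (b : K) / b)) := by
      have h1 : 1 + σ (b : K) / b = -(σ (σ (b : K)) / b) := by
        field_simp; linear_combination hsum
      rw [h1, map_div₀, map_div₀, gal_gal_gal hK]
      field_simp
    have he0 : σ (b : K) / b ≠ 0 := div_ne_zero hb1 hbK
    have he1 : 1 + σ (b : K) / b ≠ 0 := by
      intro h0
      rw [h0, zero_div, neg_zero] at hse
      exact he0 (by simpa using hse)
    refine ⟨b, t, hspan, hbγ, hb0, isShanksRoot_of_trace he0 he1 ?_, hse, ht', ?_⟩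
    · rw [← ht', hsse, hse]
    · intro hfix
      obtain ⟨q, hq⟩ := exists_rat_of_fixed hK hσ hfix
      rw [hfix, hq] at hse
      have hq0 : (q : K) ≠ 0 := hq ▸ he0
      field_simp at hse
      have h2 : q ^ 2 + q + 1 = 0 := by
        have : (q : K) ^ 2 + q + 1 = 0 := by linear_combination hse
        exact_mod_cast this
      nlinarith [sq_nonneg (2 * q + 1)]
  obtain ⟨σ, hσ⟩ := exists_ne_one hK
  obtain ⟨b, t, h1, h2, h3, h4, h5, h6, h7⟩ := key σ hσ
  by_cases ht : -1 ≤ t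
  · exact ⟨σ, b, t, h1, ⟨ht, h4, adjoin_eq_top_of_not_fixed hK h7⟩,
      isGaloisGenerator_of_ne_one hK hσ, h5⟩
  -- The parameters attached to `σ` and `σ²` satisfy `t + t' + 3 = 0`, so `t < -1` gives `t' ≥ -1`.
  · have hσ2 := sq_ne_one hK hσ
    obtain ⟨b', t', h1', h2', h3', h4', h5', h6', h7'⟩ := key (σ ^ 2) hσ2
    refine ⟨σ ^ 2, b', t', h1', ⟨?_, h4', adjoin_eq_top_of_not_fixed hK h7'⟩,
      isGaloisGenerator_of_ne_one hK hσ2, h5'⟩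
    have hsum : (t : K) + t' + 3 = 0 := by
      have hA : σ (γ : K) - γ ≠ 0 := by rw [← h2]; simpa using h3
      have hB : σ (σ (γ : K)) - σ γ ≠ 0 := by
        rw [← map_sub]; exact (map_ne_zero σ).2 hA
      have hD : (γ : K) - σ (σ γ) ≠ 0 := by
        have h0 := (map_ne_zero σ).2 hB
        rwa [map_sub, gal_gal_gal hK] at h0
      rw [← h6, ← h6', h2, h2']
      simp only [pow_two, AlgEquiv.mul_apply, map_div₀, map_sub, gal_gal_gal hK]
      rw [← neg_sub (γ : K) (σ (σ γ)), ← neg_sub (σ (σ (γ : K))) (σ γ), ← neg_sub (σ (γ : K)) γ]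
      have hs : (γ : K) - σ (σ γ) = -((σ (γ : K) - γ) + (σ (σ (γ : K)) - σ γ)) := by ring
      generalize σ (γ : K) - γ = A at *
      generalize σ (σ (γ : K)) - σ γ = B at *
      rw [hs] at hD ⊢
      have hD' : A + B ≠ 0 := neg_ne_zero.1 hD
      field_simp
      ring
    have : t + t' + 3 = 0 := by exact_mod_cast hsum
    omega

end Criterion

/-! ### The four equivalent conditions -/

section Equivalence

variable {K : Type*} [Field K] [NumberField K]

omit [NumberField K] in
theorem coe_mul_apply (x y : 𝓞 K) : ((x * y : 𝓞 K) : K) = (x : K) * (y : K) := rfl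

/-- Since `4 Δ_t = (2t + 3)² + 27`, divisibility by 81 would give a square of 3-adic valuation
exactly 3. It is used to show `3 ∤ n` when 3 ramifies. -/
theorem not_dvd_shanksDelta (t : ℤ) : ¬ 81 ∣ shanksDelta t := by
  intro h
  obtain ⟨k, r, hr, rfl⟩ : ∃ k r : ℤ, (0 ≤ r ∧ r < 9) ∧ t = 9 * k + r :=
    ⟨t / 9, t % 9, by omega, by omega⟩
  have h2 : shanksDelta (9 * k + r) = 81 * (k ^ 2) + 18 * (k * r) + r ^ 2 + 27 * k + 3 * r + 9 := by
    unfold shanksDelta; ring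
  rw [h2] at h
  obtain ⟨h0, h9⟩ := hr
  interval_cases r <;> omega

variable [IsGalois ℚ K] (hK : Module.finrank ℚ K = 3)

include hK

omit hK [IsGalois ℚ K] in
/-- An element whose norm is `±1` and which `σ` multiplies by a unit is itself a unit. -/
theorem exists_unit_eq_of_gal_eq {σ : K ≃ₐ[ℚ] K} {y : K} {v : (𝓞 K)ˣ} {s : ℤˣ}
    (hv : σ y = ((v : 𝓞 K) : K) * y) (h : y * σ y * σ (σ y) = ((s : ℤ) : K)) :
    ∃ w : (𝓞 K)ˣ, ((w : 𝓞 K) : K) = y := by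
  set S : (𝓞 K)ˣ := Units.map (Int.castRingHom (𝓞 K) : ℤ →* 𝓞 K) s
  set V : (𝓞 K)ˣ := v * Units.map ((intGal σ : 𝓞 K →+* 𝓞 K) : 𝓞 K →* 𝓞 K) v * v
  have hS : ((S : 𝓞 K) : K) = ((s : ℤ) : K) := by simp [S]
  have hS0 : ((S : 𝓞 K) : K) ≠ 0 := by simp
  have hV : ((V : 𝓞 K) : K) = ((v : 𝓞 K) : K) * σ ((v : 𝓞 K) : K) * ((v : 𝓞 K) : K) := by
    simp [V]
  -- The norm of `y` is a unit times `y³`, so `y³` is a unit and both `y` and its inverse are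
  -- integral.
  have hVy : ((V : 𝓞 K) : K) * y ^ 3 = ((S : 𝓞 K) : K) := by
    rw [hS, ← h, hV, hv, map_mul, hv]; ring
  have hy : y ≠ 0 := by
    rintro rfl
    apply hS0
    rw [← hVy]; ring
  have e1 : y ^ 3 = (((V⁻¹ * S : (𝓞 K)ˣ) : 𝓞 K) : K) := by
    have hVV : (((V⁻¹ : (𝓞 K)ˣ) : 𝓞 K) : K) * ((V : 𝓞 K) : K) = 1 := by
      rw [← map_mul, ← Units.val_mul]; simp
    rw [Units.val_mul, coe_mul_apply, ← hVy, ← mul_assoc, hVV, one_mul]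
  have e2 : y⁻¹ ^ 3 = ((((V⁻¹ * S)⁻¹ : (𝓞 K)ˣ) : 𝓞 K) : K) := by
    rw [inv_pow, e1]
    apply inv_eq_of_mul_eq_one_right
    rw [← map_mul, ← Units.val_mul]; simp
  refine exists_unit_of_isIntegral hy (IsIntegral.of_pow (n := 3) (by norm_num) ?_)
    (IsIntegral.of_pow (n := 3) (by norm_num) ?_)
  · rw [e1]; exact RingOfIntegers.isIntegral_coe _
  · rw [e2]; exact RingOfIntegers.isIntegral_coe _

/-- If `x ≡ σ x` modulo `n`, then `x` is congruent to a rational integer modulo `n`, provided that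
`3 ∤ n` in case `3` ramifies. -/
theorem exists_int_dvd_sub {σ : K ≃ₐ[ℚ] K} (hσ : σ ≠ 1) {n : ℕ}
    (hn : IsTotallyRamified K 3 → ¬ 3 ∣ n) {x : 𝓞 K} (hx : (n : 𝓞 K) ∣ x - intGal σ x) :
    ∃ a : ℤ, (n : 𝓞 K) ∣ x - a := by
  have hx2 : (n : 𝓞 K) ∣ x - intGal σ (intGal σ x) := by
    have h := map_dvd (intGal σ) hx
    rw [map_natCast, map_sub] at h
    convert dvd_add hx h using 1
    ring
  obtain ⟨t, ht⟩ := exists_int_trace hK hσ x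
  have h3 : (n : 𝓞 K) ∣ 3 * x - t := by
    convert dvd_add hx hx2 using 1
    rw [← ht]; ring
  -- So far `3 x` is an integer modulo `n`. If 3 ramifies, 3 is invertible modulo `n`; otherwise
  -- some `y` has trace `T` prime to 3, `T x ≡ Tr(y x)` modulo `n`, and a Bézout relation between 3
  -- and `T` finishes.
  by_cases hr : IsTotallyRamified K 3
  · have hco : IsCoprime (3 : ℤ) n := by
      rw [show (3 : ℤ) = (3 : ℕ) by rfl, Nat.isCoprime_iff_coprime]
      exact (Nat.Prime.coprime_iff_not_dvd Nat.prime_three).2 (hn hr)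
    obtain ⟨a, b, hab⟩ := hco
    have hab' : (a : 𝓞 K) * 3 + b * n = 1 := by exact_mod_cast hab
    refine ⟨a * t, ?_⟩
    convert dvd_add (h3.mul_left (a : 𝓞 K)) ((dvd_refl (n : 𝓞 K)).mul_left (b * x)) using 1
    push_cast
    linear_combination -x * hab'
  · obtain ⟨y, T, hT, hT3⟩ := exists_trace_not_dvd hK hr hσ
    obtain ⟨m, hm⟩ := exists_int_trace hK hσ (y * x)
    have h4 : (n : 𝓞 K) ∣ T * x - m := by
      convert dvd_add (hx.mul_left (intGal σ y)) (hx2.mul_left (intGal σ (intGal σ y))) using 1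
      rw [← hT, ← hm]
      simp only [map_mul]
      ring
    have hco : IsCoprime (3 : ℤ) T := (Int.prime_three.coprime_iff_not_dvd).2 hT3
    obtain ⟨a, b, hab⟩ := hco
    have hab' : (a : 𝓞 K) * 3 + b * T = 1 := by exact_mod_cast hab
    refine ⟨a * t + b * m, ?_⟩
    convert dvd_add (h3.mul_left (a : 𝓞 K)) (h4.mul_left (b : 𝓞 K)) using 1
    push_cast
    linear_combination -x * hab'

variable {C : Ideal (𝓞 K)}

theorem exists_mul_gal_eq_conductor (hC : Ideal.absNorm C = conductor K) {β : 𝓞 K}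
    (hβ : C = Ideal.span {β}) {σ : K ≃ₐ[ℚ] K} (hσ : σ ≠ 1) :
    ∃ s : ℤˣ, (β : K) * σ β * σ (σ (β : K)) = ((s : ℤ) : K) * conductor K := by
  have h1 : (Algebra.norm ℤ β).natAbs = conductor K := by
    rw [← hC, hβ, Ideal.absNorm_span_singleton]
  have h2 := norm_eq_mul_mul hK hσ (β : K)
  rw [← Algebra.coe_norm_int] at h2
  rw [← h2, ← h1]
  rcases Int.natAbs_eq (Algebra.norm ℤ β) with h | h
  · refine ⟨1, ?_⟩
    rw [← Int.cast_natCast (Algebra.norm ℤ β).natAbs, ← h]; simp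
  · refine ⟨-1, ?_⟩
    have h' : (((Algebra.norm ℤ β).natAbs : ℕ) : ℤ) = -Algebra.norm ℤ β := by omega
    rw [← Int.cast_natCast (Algebra.norm ℤ β).natAbs, h']; simp

theorem exists_gal_div_eq_unit (hC : Ideal.absNorm C = conductor K) {β : 𝓞 K}
    (hβ : C = Ideal.span {β}) (σ : K ≃ₐ[ℚ] K) :
    ∃ u : (𝓞 K)ˣ, ((u : 𝓞 K) : K) = σ (β : K) / β := by
  have hβ0 : (β : K) ≠ 0 := by simpa using ne_zero_of_span_eq hK hC hβ
  obtain ⟨u, hu⟩ := exists_unit_gal_eq hK hC hβ σ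
  refine ⟨u, ?_⟩
  rw [eq_div_iff hβ0]
  simpa using (congrArg (fun y : 𝓞 K => (y : K)) hu).symm

/-- The quotient `(θ - σ θ) / (n β)` has norm `± 1` and is multiplied by a unit under `σ`, so it is
a unit `w`. Then `θ = a + n g` with `a` an integer, and `g - σ g = w β`. -/
theorem isMonogenic_of_shanksDelta_eq (hC : Ideal.absNorm C = conductor K) {β : 𝓞 K}
    (hβ : C = Ideal.span {β}) {t : ℤ} (ht : IsSimplestField K t) {n : ℕ}
    (hn : shanksDelta t = n ^ 3 * conductor K) : IsMonogenic K := by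
  obtain ⟨θ, hθ⟩ := ht
  obtain ⟨σ, hd⟩ := hθ.exists_datum hK
  have hσ := ne_one_of_isGaloisGenerator hK hd.2.1
  have hβ0 : (β : K) ≠ 0 := by simpa using ne_zero_of_span_eq hK hC hβ
  have hc0 : (conductor K : K) ≠ 0 := by exact_mod_cast conductor_ne_zero hK
  have hn0 : (n : K) ≠ 0 := by
    rintro h0
    have hn' : n = 0 := by exact_mod_cast h0
    have := shanksDelta_pos t
    rw [hn, hn'] at this
    simp at this
  obtain ⟨s, hs⟩ := exists_mul_gal_eq_conductor hK hC hβ hσ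
  obtain ⟨u, hu⟩ := exists_gal_div_eq_unit hK hC hβ σ
  obtain ⟨v, hv⟩ := ((hθ.2.1.gal σ).gal σ).exists_unit
  have hu' : (((u⁻¹ : (𝓞 K)ˣ) : 𝓞 K) : K) = β / σ (β : K) := by
    have h1 : (((u⁻¹ : (𝓞 K)ˣ) : 𝓞 K) : K) * ((u : 𝓞 K) : K) = 1 := by
      rw [← map_mul, ← Units.val_mul]; simp
    rw [eq_inv_of_mul_eq_one_left h1, hu, inv_div]
  have hσβ : σ (β : K) ≠ 0 := (map_ne_zero σ).2 hβ0
  have hσσβ : σ (σ (β : K)) ≠ 0 := (map_ne_zero σ).2 hσβ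
  have hΔ : (shanksDelta t : K) = n ^ 3 * conductor K := by rw [hn]; push_cast; rfl
  obtain ⟨w, hw⟩ := exists_unit_eq_of_gal_eq (σ := σ) (y := (θ - σ θ) / (n * β))
    (v := v * u⁻¹) (s := s⁻¹) (by
      rw [map_div₀, map_mul, map_natCast, hd.gal_sub hK, Units.val_mul, coe_mul_apply, hv, hu']
      field_simp) (by
      have h1 := hd.norm_sub hK
      have hss : ((s : ℤ) : K) * ((s⁻¹ : ℤˣ) : ℤ) = 1 := by
        rw [← Int.cast_mul, ← Units.val_mul]; simp
      simp only [map_div₀, map_mul, map_natCast]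
      have h2 : (θ - σ θ) * σ (θ - σ θ) * σ (σ (θ - σ θ)) =
          ((s⁻¹ : ℤˣ) : ℤ) * n ^ 3 * ((β : K) * σ β * σ (σ (β : K))) := by
        rw [h1, hs, hΔ]; linear_combination -(n ^ 3 * conductor K : K) * hss
      rw [div_mul_div_comm, div_mul_div_comm, h2]
      field_simp)
  rw [eq_div_iff (mul_ne_zero hn0 hβ0)] at hw
  let ϑ : 𝓞 K := ⟨θ, isIntegral_of_isShanksRoot hθ.2.1⟩
  have hϑ : ϑ - intGal σ ϑ = n * (w * β) := by
    apply RingOfIntegers.coe_injective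
    have h1 : ((ϑ - intGal σ ϑ : 𝓞 K) : K) = θ - σ θ := rfl
    refine h1.trans ?_
    rw [← hw]
    simp only [map_mul, map_natCast]
    ring
  obtain ⟨a, g, hg⟩ := exists_int_dvd_sub hK hσ (n := n) (fun hr h3 => by
    obtain ⟨k, rfl⟩ := h3
    obtain ⟨l, hl⟩ := (conductor_spec hK).2.2 hr
    apply not_dvd_shanksDelta t
    rw [hn, hl]
    refine ⟨k ^ 3 * 3 * l, ?_⟩
    push_cast
    ring) ⟨_, hϑ⟩
  refine isMonogenic_of_span_sub_eq hK hC hσ (g := g) ?_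
  have hgg : g - intGal σ g = w * β := by
    have hn0' : (n : 𝓞 K) ≠ 0 := by
      have : n ≠ 0 := by exact_mod_cast hn0
      exact_mod_cast this
    apply mul_left_cancel₀ hn0'
    rw [← hϑ]
    have h2 := congrArg (intGal σ) hg
    simp only [map_sub, map_mul, map_natCast, map_intCast] at h2
    linear_combination h2 - hg
  rw [hgg, Ideal.span_singleton_mul_left_unit w.isUnit, hβ]

omit hK [NumberField K] [IsGalois ℚ K] in
theorem exists_unit_mul_eq_of_span_eq {a b : 𝓞 K} (h : Ideal.span {a} = Ideal.span {b}) :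
    ∃ w : (𝓞 K)ˣ, (b : K) = a * ((w : 𝓞 K) : K) := by
  obtain ⟨w, hw⟩ := Ideal.span_singleton_eq_span_singleton.1 h
  exact ⟨w, by rw [← hw, coe_mul_apply]⟩

theorem exists_normOneUnits_val_eq_gal_div (hC : Ideal.absNorm C = conductor K) {β : 𝓞 K}
    (hβ : C = Ideal.span {β}) {σ : K ≃ₐ[ℚ] K} (hσ : σ ≠ 1) :
    ∃ u : normOneUnits K, normOneUnits.val u = σ (β : K) / β := by
  have hβ0 : (β : K) ≠ 0 := by simpa using ne_zero_of_span_eq hK hC hβ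
  have hσβ : σ (β : K) ≠ 0 := (map_ne_zero σ).2 hβ0
  have hσσβ : σ (σ (β : K)) ≠ 0 := (map_ne_zero σ).2 hσβ
  obtain ⟨u, hu⟩ := exists_gal_div_eq_unit hK hC hβ σ
  refine exists_normOneUnits_val_eq hK hσ u hu ?_
  simp only [map_div₀, gal_gal_gal hK]
  field_simp

omit hK [IsGalois ℚ K] in
theorem H1.mk_eq_mk_of_span_eq {β β' : 𝓞 K} (h : Ideal.span {β} = Ideal.span {β'})
    {σ : K ≃ₐ[ℚ] K} {u u' : normOneUnits K} (hu : normOneUnits.val u = σ (β : K) / β)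
    (hu' : normOneUnits.val u' = σ (β' : K) / β') : H1.mk σ u = H1.mk σ u' := by
  obtain ⟨w, hw⟩ := exists_unit_mul_eq_of_span_eq h
  rw [H1.mk_eq_mk_iff]
  refine ⟨w, ?_⟩
  rw [hu, hu', hw, map_mul, div_mul_div_comm]

theorem IsSimplestWith.exists_normOneUnits {t : ℤ} {θ : K} (h : IsSimplestWith t θ) :
    ∃ v : normOneUnits K, normOneUnits.val v = θ := by
  obtain ⟨σ, hσ⟩ := exists_ne_one hK
  obtain ⟨v, hv⟩ := h.2.1.exists_unit
  exact exists_normOneUnits_val_eq hK hσ v hv (h.vieta hK hσ).2.2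

theorem exists_mk_eq_mk_of_isMonogenic (hC : Ideal.absNorm C = conductor K) {β : 𝓞 K}
    (hβ : C = Ideal.span {β}) (h : IsMonogenic K) :
    ∃ t : ℤ, IsSimplestField K t ∧ ∀ θ : K, IsSimplestWith t θ →
      ∃ σ : K ≃ₐ[ℚ] K, IsShanksDatum t θ σ ∧ ∃ u v : normOneUnits K,
        normOneUnits.val u = σ (β : K) / β ∧ normOneUnits.val v = θ ∧
        H1.mk σ u = H1.mk σ v := by
  obtain ⟨σ, b, t, hb, hd⟩ := exists_datum_of_isMonogenic hK hC h
  refine ⟨t, ⟨_, hd.1⟩, fun θ hθ => ?_⟩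
  have hσ := ne_one_of_isGaloisGenerator hK hd.2.1
  obtain ⟨u, hu⟩ := exists_normOneUnits_val_eq_gal_div hK hC hβ hσ
  obtain ⟨v, hv⟩ := hθ.exists_normOneUnits hK
  obtain ⟨v', hv'⟩ := hd.1.exists_normOneUnits hK
  have huv := H1.mk_eq_mk_of_span_eq (hβ.symm.trans hb) hu hv'
  generalize σ (b : K) / b = e at *
  have he := hd.2.2
  have he0 := hd.1.2.1.ne_zero
  have he0' : σ e ≠ 0 := (map_ne_zero σ).2 he0
  obtain ⟨w, hw⟩ := hd.1.2.1.exists_unit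
  obtain ⟨w', hw'⟩ := (hd.1.2.1.gal σ).exists_unit
  have hee : σ (σ e) = -((1 + σ e) / σ e) := by
    conv_lhs => rw [he]
    simp
  have heee : σ (σ (σ e)) = -((1 + σ (σ e)) / σ (σ e)) := by
    conv_lhs => rw [hee]
    simp
  -- The prescribed root is a conjugate of `e`, and conjugate units have the same class: `σ e = e ·
  -- (σ e / e)`, and `σ² e` differs from `e` by the coboundary of `e σ(e)`.
  rcases hd.1.eq_of_isShanksRoot hK hθ.2.1 hσ with rfl | rfl | rfl
  · refine ⟨σ, hd, u, v, hu, hv, huv.trans ((H1.mk_eq_mk_iff ..).2 ⟨1, ?_⟩)⟩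
    rw [hv, hv']; simp
  · refine ⟨σ, ⟨hθ, hd.2.1, hee⟩, u, v, hu, hv, huv.trans ((H1.mk_eq_mk_iff ..).2 ⟨w, ?_⟩)⟩
    rw [hv, hv', hw]; field_simp
  · refine ⟨σ, ⟨hθ, hd.2.1, heee⟩, u, v, hu, hv,
      huv.trans ((H1.mk_eq_mk_iff ..).2 ⟨w * w', ?_⟩)⟩
    rw [hv, hv', Units.val_mul, coe_mul_apply, hw, hw', map_mul]; field_simp

theorem IsShanksDatum.exists_mk_eq_mk_of_mk_eq_mk (hC : Ideal.absNorm C = conductor K) {β : 𝓞 K}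
    (hβ : C = Ideal.span {β}) {t : ℤ} {θ : K} {σ : K ≃ₐ[ℚ] K} (hd : IsShanksDatum t θ σ)
    {u v : normOneUnits K} (hu : normOneUnits.val u = σ (β : K) / β)
    (hv : normOneUnits.val v = θ) (huv : H1.mk σ u = H1.mk σ v) :
    ∃ A B : principalAmbiguousIdeals K,
      principalAmbiguousIdeals.val A = (C : FractionalIdeal (𝓞 K)⁰ K) ∧
      principalAmbiguousIdeals.val B = FractionalIdeal.spanSingleton (𝓞 K)⁰ (θ - σ θ) ∧
      AmbiguousQuotient.mk A = AmbiguousQuotient.mk B := by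
  have hσ := ne_one_of_isGaloisGenerator hK hd.2.1
  have hβ0 : (β : K) ≠ 0 := by simpa using ne_zero_of_span_eq hK hC hβ
  obtain ⟨w, hw⟩ := (H1.mk_eq_mk_iff σ u v).1 huv
  rw [hu, hv] at hw
  have hw0 : ((w : 𝓞 K) : K) ≠ 0 := by simp
  obtain ⟨x, hx⟩ := hd.1.2.1.exists_unit
  obtain ⟨x', hx'⟩ := (hd.1.2.1.gal σ).exists_unit
  obtain ⟨x'', hx''⟩ := ((hd.1.2.1.gal σ).gal σ).exists_unit
  obtain ⟨u', hu'⟩ := exists_unit_gal_eq hK hC hβ σ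
  have hβσ : σ (β : K) = ((u' : 𝓞 K) : K) * β := by
    simpa using congrArg (fun y : 𝓞 K => (y : K)) hu'
  have hδ0 : θ - σ θ ≠ 0 := sub_ne_zero.2 (hd.1.gal_ne hK hσ).symm
  obtain ⟨A, hA⟩ := exists_principalAmbiguousIdeals_val_eq hK hσ hβ0 hβσ
  obtain ⟨B, hB⟩ := exists_principalAmbiguousIdeals_val_eq hK hσ hδ0 (u := x'')
    (by rw [hx'']; exact hd.gal_sub hK)
  refine ⟨A, B, ?_, hB, ?_⟩
  · rw [hA, hβ, FractionalIdeal.coeIdeal_span_singleton]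
  have hθ0 := hd.1.2.1.ne_zero
  have hv3 := (hd.1.vieta hK hσ).2.2
  -- `σ` multiplies `w β` by `θ`; the extra factor `θ σ θ` changes this multiplier to `σ²θ`, the one
  -- of `θ - σ θ`. The quotient of the two is thus fixed, hence rational.
  set y : K := θ * σ θ * (w * β) with hy
  have hy0 : y ≠ 0 := by
    rw [hy]
    exact mul_ne_zero (mul_ne_zero hθ0 ((map_ne_zero σ).2 hθ0)) (mul_ne_zero hw0 hβ0)
  have hwβ : σ (w : K) * σ β = θ * (w * β) := by
    rw [hw]; field_simp
  have hyσ : σ y = σ (σ θ) * y := by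
    rw [hy, map_mul, map_mul, map_mul, hwβ]; ring
  obtain ⟨q, hq⟩ := exists_rat_of_fixed hK hσ (x := (θ - σ θ) / y) (by
    have h2 : σ (σ θ) ≠ 0 := (map_ne_zero σ).2 ((map_ne_zero σ).2 hθ0)
    rw [map_div₀, hyσ, hd.gal_sub hK, mul_div_mul_left _ _ h2])
  rw [div_eq_iff hy0] at hq
  refine (AmbiguousQuotient.mk_eq_mk_iff hA hB).2 ⟨q, x * x' * w, ?_, ?_⟩
  · rintro rfl
    apply hδ0
    rw [hq]; simp
  · rw [hq, hy, Units.val_mul, Units.val_mul, coe_mul_apply, coe_mul_apply, hx, hx']; ring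

/-- A prime in the denominator of `r` would divide `c_K` three times, but `c_K` is cube-free;
positivity of `d` settles the sign of `r`. -/
theorem exists_nat_div_conductor_eq {d : ℤ} (hd : 0 < d) {r : ℚ}
    (h : (d : ℚ) = r ^ 3 * conductor K) :
    ∃ n : ℕ, (d : ℚ) / conductor K = (n : ℚ) ^ 3 := by
  have hc0 : (0 : ℚ) < conductor K := by
    exact_mod_cast Nat.pos_of_ne_zero (conductor_ne_zero hK)
  have hden : r.den = 1 := by
    by_contra hne
    obtain ⟨p, hp, hpd⟩ := Nat.exists_prime_and_dvd hne
    apply not_cube_dvd_conductor hK hp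
    refine (pow_dvd_pow_of_dvd hpd 3).trans ?_
    have h1 : (r.den : ℤ) ^ 3 * d = r.num ^ 3 * conductor K := by
      have h2 : (r.den : ℚ) ≠ 0 := by exact_mod_cast r.den_ne_zero
      have h3 : (r.den : ℚ) ^ 3 * d = (r.num : ℚ) ^ 3 * conductor K := by
        rw [h, ← Rat.mul_den_eq_num]; ring
      exact_mod_cast h3
    have hco : IsCoprime ((r.den : ℤ) ^ 3) (r.num ^ 3) :=
      (IsCoprime.pow (Rat.isCoprime_num_den r)).symm
    have h4 : ((r.den : ℤ) ^ 3) ∣ conductor K := hco.dvd_of_dvd_mul_left ⟨d, h1.symm⟩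
    exact_mod_cast h4
  have hr0 : 0 < r := by
    have h1 : (0 : ℚ) < r ^ 3 * conductor K := by rw [← h]; exact_mod_cast hd
    have h2 : 0 < r ^ 3 := (mul_pos_iff_of_pos_right hc0).1 h1
    exact (Odd.pow_pos_iff (by decide)).1 h2
  refine ⟨r.num.toNat, ?_⟩
  have h5 : ((r.num.toNat : ℕ) : ℚ) = r := by
    rw [← Int.cast_natCast, Int.toNat_of_nonneg (Rat.num_nonneg.2 hr0.le)]
    exact Rat.coe_int_num_of_den_eq_one hden
  rw [h5, h, mul_div_cancel_right₀ _ hc0.ne']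

theorem IsShanksDatum.exists_nat_of_mk_eq_mk (hC : Ideal.absNorm C = conductor K) {β : 𝓞 K}
    (hβ : C = Ideal.span {β}) {t : ℤ} {θ : K} {σ : K ≃ₐ[ℚ] K} (hd : IsShanksDatum t θ σ)
    {A B : principalAmbiguousIdeals K}
    (hA : principalAmbiguousIdeals.val A = (C : FractionalIdeal (𝓞 K)⁰ K))
    (hB : principalAmbiguousIdeals.val B = FractionalIdeal.spanSingleton (𝓞 K)⁰ (θ - σ θ))
    (hAB : AmbiguousQuotient.mk A = AmbiguousQuotient.mk B) :
    ∃ n : ℕ, (shanksDelta t : ℚ) / conductor K = (n : ℚ) ^ 3 := by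
  have hσ := ne_one_of_isGaloisGenerator hK hd.2.1
  rw [hβ, FractionalIdeal.coeIdeal_span_singleton] at hA
  obtain ⟨q, u, -, h⟩ := (AmbiguousQuotient.mk_eq_mk_iff hA hB).1 hAB
  have hβ' : C = Ideal.span {(u : 𝓞 K) * β} := by
    rw [Ideal.span_singleton_mul_left_unit u.isUnit, hβ]
  obtain ⟨s, hs⟩ := exists_mul_gal_eq_conductor hK hC hβ' hσ
  have hn := hd.norm_sub hK
  have h' : θ - σ θ = q * (((u : 𝓞 K) * β : 𝓞 K) : K) := by
    rw [h, coe_mul_apply]; ring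
  have hσq : σ (q : K) = q := map_ratCast σ q
  rw [h'] at hn
  simp only [map_mul σ (q : K), hσq] at hn
  have hs3 : (s : ℤ) ^ 3 = s := by
    rcases Int.units_eq_one_or s with rfl | rfl <;> norm_num
  -- The sign `s` of the norm of the generator is absorbed into the cube, since `s³ = s`.
  refine exists_nat_div_conductor_eq hK (shanksDelta_pos t) (r := (s : ℤ) * q) ?_
  have hkey : (shanksDelta t : K) = (((s : ℤ) : K) * q) ^ 3 * conductor K := by
    have hs3' : ((s : ℤ) : K) ^ 3 = (s : ℤ) := by exact_mod_cast congrArg (Int.cast (R := K)) hs3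
    rw [mul_pow, hs3', ← hn]
    linear_combination (q : K) ^ 3 * hs
  exact_mod_cast hkey

end Equivalence

end CyclicCubic

end

theorem theorem2 (K : Type*) [Field K] [NumberField K] [IsGalois ℚ K]
    (hK : Module.finrank ℚ K = 3) :
    -- the ideal of norm `c_K` exists and is unique
    (∃! C : Ideal (𝓞 K), Ideal.absNorm C = CyclicCubic.conductor K) ∧
    ∀ C : Ideal (𝓞 K), Ideal.absNorm C = CyclicCubic.conductor K →
      -- (i)
      (CyclicCubic.IsMonogenic K → CyclicCubic.IsSimplest K ∧ C.IsPrincipal) ∧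
      -- (ii)
      (CyclicCubic.IsSimplest K → ∀ β : 𝓞 K, C = Ideal.span {β} →
        -- any choice of the roots `θ_t`, for all `t` with `K = K_t`
        (∀ θ : ℤ → K, (∀ t : ℤ, CyclicCubic.IsSimplestField K t →
            CyclicCubic.IsSimplestWith t (θ t)) →
          List.TFAE [
            CyclicCubic.IsMonogenic K,
            ∃ t : ℤ, CyclicCubic.IsSimplestField K t ∧
              ∃ σ : K ≃ₐ[ℚ] K, CyclicCubic.IsShanksDatum t (θ t) σ ∧
              ∃ u v : CyclicCubic.normOneUnits K,
                CyclicCubic.normOneUnits.val u = σ (β : K) / (β : K) ∧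
                CyclicCubic.normOneUnits.val v = θ t ∧
                CyclicCubic.H1.mk σ u = CyclicCubic.H1.mk σ v,
            ∃ t : ℤ, CyclicCubic.IsSimplestField K t ∧
              ∃ σ : K ≃ₐ[ℚ] K, CyclicCubic.IsShanksDatum t (θ t) σ ∧
              ∃ A B : CyclicCubic.principalAmbiguousIdeals K,
                CyclicCubic.principalAmbiguousIdeals.val A = (C : FractionalIdeal (𝓞 K)⁰ K) ∧
                CyclicCubic.principalAmbiguousIdeals.val B =
                  FractionalIdeal.spanSingleton (𝓞 K)⁰ (θ t - σ (θ t)) ∧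
                CyclicCubic.AmbiguousQuotient.mk A = CyclicCubic.AmbiguousQuotient.mk B,
            ∃ t : ℤ, CyclicCubic.IsSimplestField K t ∧
              ∃ n : ℕ, (CyclicCubic.shanksDelta t : ℚ) / (CyclicCubic.conductor K : ℚ) =
                (n : ℚ) ^ 3]) ∧
        -- `β^{σ-1}` is a unit of norm `1`, whose class does not depend on the choice of `β`
        (∀ σ : K ≃ₐ[ℚ] K, CyclicCubic.IsGaloisGenerator σ →
          (∃ u : CyclicCubic.normOneUnits K,
            CyclicCubic.normOneUnits.val u = σ (β : K) / (β : K)) ∧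
          ∀ β' : 𝓞 K, C = Ideal.span {β'} →
            ∀ u u' : CyclicCubic.normOneUnits K,
              CyclicCubic.normOneUnits.val u = σ (β : K) / (β : K) →
              CyclicCubic.normOneUnits.val u' = σ (β' : K) / (β' : K) →
              CyclicCubic.H1.mk σ u = CyclicCubic.H1.mk σ u')) := by
  obtain ⟨σ₀, hσ₀⟩ := CyclicCubic.exists_ne_one hK
  refine ⟨⟨CyclicCubic.differenceIdeal σ₀, CyclicCubic.absNorm_differenceIdeal hK hσ₀, fun C hC =>
    CyclicCubic.ideal_eq_of_absNorm_eq_conductor hK hC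
      (CyclicCubic.absNorm_differenceIdeal hK hσ₀)⟩, fun C hC => ⟨fun h => ?_, ?_⟩⟩
  · obtain ⟨σ, b, t, hb, hd⟩ := CyclicCubic.exists_datum_of_isMonogenic hK hC h
    exact ⟨⟨t, _, hd.1⟩, ⟨b, hb⟩⟩
  · intro _ β hβ
    refine ⟨fun θ hθ => ?_, fun σ hσ => ⟨?_, ?_⟩⟩
    · tfae_have 1 → 2 := fun h => by
        obtain ⟨t, ht, hall⟩ := CyclicCubic.exists_mk_eq_mk_of_isMonogenic hK hC hβ h
        exact ⟨t, ht, hall (θ t) (hθ t ht)⟩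
      tfae_have 2 → 3 := by
        rintro ⟨t, ht, σ, hd, u, v, hu, hv, huv⟩
        exact ⟨t, ht, σ, hd, hd.exists_mk_eq_mk_of_mk_eq_mk hK hC hβ hu hv huv⟩
      tfae_have 3 → 4 := by
        rintro ⟨t, ht, σ, hd, A, B, hA, hB, hAB⟩
        exact ⟨t, ht, hd.exists_nat_of_mk_eq_mk hK hC hβ hA hB hAB⟩
      tfae_have 4 → 1 := by
        rintro ⟨t, ht, n, hn⟩
        have hc : (CyclicCubic.conductor K : ℚ) ≠ 0 := by
          exact_mod_cast CyclicCubic.conductor_ne_zero hK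
        rw [div_eq_iff hc] at hn
        exact CyclicCubic.isMonogenic_of_shanksDelta_eq hK hC hβ ht (by exact_mod_cast hn)
      tfae_finish
    · exact CyclicCubic.exists_normOneUnits_val_eq_gal_div hK hC hβ
        (CyclicCubic.ne_one_of_isGaloisGenerator hK hσ)
    · intro β' hβ' u u' hu hu'
      exact CyclicCubic.H1.mk_eq_mk_of_span_eq (hβ.symm.trans hβ') hu hu'
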